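/- Let $\mathcal U,\mathcal V,\mathcal X$ be finite-dimensional real inner product spaces; equip $\mathcal U\times\mathcal V$ with the product inner product and write $w=(u,v)$. Consider $$\min_{u,v}\ \theta(u,v):=p(u)+q(v)+\phi(u,v)\quad\text{s.t.}\quad \mathcal A^*u+\mathcal B^*v=c,\tag{P}$$ where $p:\mathcal U\to(-\infty,\infty]$ and $q:\mathcal V\to(-\infty,\infty]$ are closed proper convex functions, $\phi:\mathcal U\times\mathcal V\to\mathbb R$ is convex and differentiable with Lipschitz continuous gradient, $\mathcal A:\mathcal X\to\mathcal U$ and $\mathcal B:\mathcal X\to\mathcal V$ are linear, and $c\in\mathcal X$. For a self-adjoint operator $\mathcal G$ put $\|x\|_{\mathcal G}^2=\langle x,\mathcal Gx\rangle$. Let $\partial^2\phi(w)$ be Clarke's generalized Hessian, i.e. the convex hull of all limits of $\nabla^2\phi(w^k)$ along sequences $w^k\to w$ of points at which $\nabla^2\phi$ exists. Let $\mathcal Q$ on $\mathcal U\times\mathcal V$, $\mathcal D_1$ on $\mathcal U$ and $\mathcal D_2$ on $\mathcal V$ be self-adjoint positive semidefinite operators such that, with $\mathcal H=\mathrm{Diag}(\mathcal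 D_1,\mathcal D_2)$, $$\mathcal Q\preceq\mathcal W\preceq\mathcal Q+\mathcal H\qquad\text{for all } w \text{ and all } \mathcal W\in\partial^2\phi(w).$$ Write $\mathcal Q_{ij}$, $\mathcal W_{ij}$ for the blocks of $\mathcal Q$, $\mathcal W$, and let $\eta\in[0,1]$ satisfy $$|\langle u,(\mathcal W_{12}-\mathcal Q_{12})v\rangle|\le\tfrac{\eta}{2}\bigl(\|u\|_{\mathcal D_1}^2+\|v\|_{\mathcal D_2}^2\bigr)$$ for all $u\in\mathcal U$, $v\in\mathcal V$ and all $\mathcal W\in\partial^2\phi(w)$, $w\in\mathcal U\times\mathcal V$. Let $\sigma>0$, $\tau>0$, and let $\mathcal S$ on $\mathcal U$ and $\mathcal T$ on $\mathcal V$ be self-adjoint positive semidefinite. With $$\hat\phi(w;w')=\phi(w')+\langle\nabla\phi(w'),w-w'\rangle+\tfrac12\|w'-w\|^2_{\mathcal Q+\mathcal H},$$ $$\widehat{\mathcal L}_\sigma(w;(x,w'))=p(u)+q(v)+\hat\phi(w;w')+\langle x,\mathcal A^*u+\mathcal B^*v-c\rangle+\tfrac\sigma2\|\mathcal A^*u+\mathcal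 B^*v-c\|^2,$$ let $(u^k,v^k,x^k)_{k\ge0}$ be generated by the majorized ADMM: $u^0\in\mathrm{dom}(p)$, $v^0\in\mathrm{dom}(q)$, $x^0\in\mathcal X$ and, for $k\ge0$, with $w^k=(u^k,v^k)$, $$u^{k+1}\in\arg\min_{u}\bigl\{\widehat{\mathcal L}_\sigma(u,v^k;(x^k,w^k))+\tfrac12\|u-u^k\|_{\mathcal S}^2\bigr\},$$ $$v^{k+1}\in\arg\min_{v}\bigl\{\widehat{\mathcal L}_\sigma(u^{k+1},v;(x^k,w^k))+\tfrac12\|v-v^k\|_{\mathcal T}^2\bigr\},$$ $$x^{k+1}=x^k+\tau\sigma(\mathcal A^*u^{k+1}+\mathcal B^*v^{k+1}-c).$$ **Theorem.** Suppose that the solution set of (P) is nonempty, that there is $(\hat u,\hat v)\in\mathrm{ri}(\mathrm{dom}(p)\times\mathrm{dom}(q))$ with $\mathcal A^*\hat u+\mathcal B^*\hat v=c$, and that $$\mathcal Q_{11}+\sigma\mathcal A\mathcal A^*+\mathcal S\succ0,\qquad \mathcal Q_{22}+\sigma\mathcal B\mathcal B^*+\mathcal T\succ0.$$ (i) Assume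 $\tau\in(0,1]$ and that for every $w=(u,v)\in\mathcal U\times\mathcal V$ $$\langle w,[\mathcal Q+\mathrm{Diag}(\mathcal S+(1-\tau)\sigma\mathcal A\mathcal A^*,\ \mathcal T+(1-\tau)\sigma\mathcal B\mathcal B^*)]w\rangle=0\ \Rightarrow\ \|u\|\,\|v\|=0.$$ Then $(u^k,v^k)$ converges to an optimal solution $(\bar u,\bar v)$ of (P) and $x^k$ converges to a corresponding optimal multiplier $\bar x$, i.e. $(\bar u,\bar v,\bar x)$ satisfies the KKT conditions $0\in\partial p(\bar u)+\nabla_u\phi(\bar u,\bar v)+\mathcal A\bar x$, $0\in\partial q(\bar v)+\nabla_v\phi(\bar u,\bar v)+\mathcal B\bar x$, $\mathcal A^*\bar u+\mathcal B^*\bar v=c$. (ii) Assume $\tau\in(0,\frac{1+\sqrt5}{2})$ and $$\mathcal M:=\tfrac14\mathcal Q+\mathrm{Diag}(\mathcal S-\eta\mathcal D_1,\ \mathcal T-\eta\mathcal D_2)\succeq0,$$ $$\tfrac14\mathcal Q_{11}+\mathcal S+\sigma\mathcal A\mathcal A^*-\eta\mathcal D_1\succ0,\qquad \tfrac14\mathcal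 Q_{22}+\mathcal T+\sigma\mathcal B\mathcal B^*-\eta\mathcal D_2\succ0,$$ and that for every $w=(u,v)\in\mathcal U\times\mathcal V$ $$\langle w,[\mathcal M+\sigma\,\mathrm{Diag}(\mathcal A\mathcal A^*,\mathcal B\mathcal B^*)]w\rangle=0\ \Rightarrow\ \|u\|\,\|v\|=0.$$ Then the same conclusion holds. -/

import Mathlib

open Filter Topology

noncomputable section

namespace MajorizedADMM

variable {E U V X : Type*}
  [NormedAddCommGroup E] [InnerProductSpace ℝ E] [FiniteDimensional ℝ E]
  [NormedAddCommGroup U] [InnerProductSpace ℝ U] [FiniteDimensional ℝ U]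
  [NormedAddCommGroup V] [InnerProductSpace ℝ V] [FiniteDimensional ℝ V]
  [NormedAddCommGroup X] [InnerProductSpace ℝ X] [FiniteDimensional ℝ X]

/-! ### Extended-real-valued convex functions -/

/-- The effective domain `{x | f x < +∞}`. -/
def dom (f : E → EReal) : Set E := {x | f x < ⊤}

/-- Closed proper convex functions `f : E → (-∞, +∞]`: never `-∞`, somewhere finite,
with convex epigraph, and lower semicontinuous. -/
structure IsClosedProperConvex (f : E → EReal) : Prop where
  ne_bot : ∀ x, f x ≠ ⊥
  dom_nonempty : (dom f).Nonempty
  convex_epigraph : Convex ℝ {z : E × ℝ | f z.1 ≤ (z.2 : EReal)}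
  lowerSemicontinuous : LowerSemicontinuous f

/-- The convex subdifferential `∂f(x) = {ξ | f y ≥ f x + ⟨ξ, y - x⟩ for all y}`. -/
def subdifferential (f : E → EReal) (x : E) : Set E :=
  {ξ | ∀ y, f x + ((inner ℝ ξ (y - x) : ℝ) : EReal) ≤ f y}

/-! ### Self-adjoint operators -/

/-- `G ≻ 0`: `G` is self-adjoint and `⟨x, G x⟩ > 0` for every `x ≠ 0`. -/
def PosDef (G : E →L[ℝ] E) : Prop :=
  IsSelfAdjoint G ∧ ∀ x, x ≠ 0 → 0 < inner ℝ x (G x)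

/-- `‖x‖²_G = ⟨x, G x⟩`. -/
def normSq (G : E →L[ℝ] E) (x : E) : ℝ := inner ℝ x (G x)

/-! ### The Euclidean product space and block operators -/

variable (U V) in
/-- The Euclidean product space `U × V`, with inner product
`⟨(u, v), (u', v')⟩ = ⟨u, u'⟩ + ⟨v, v'⟩`. -/
abbrev Prod2 : Type _ := WithLp 2 (U × V)

/-- The point `w = (u, v)`. -/
abbrev pair (u : U) (v : V) : Prod2 U V := WithLp.toLp 2 (u, v)

variable (U V) in
/-- The embedding `u ↦ (u, 0)`. -/
def inl : U →L[ℝ] Prod2 U V :=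
  (WithLp.prodContinuousLinearEquiv 2 ℝ U V).symm.toContinuousLinearMap ∘L
    ContinuousLinearMap.inl ℝ U V

variable (U V) in
/-- The embedding `v ↦ (0, v)`. -/
def inr : V →L[ℝ] Prod2 U V :=
  (WithLp.prodContinuousLinearEquiv 2 ℝ U V).symm.toContinuousLinearMap ∘L
    ContinuousLinearMap.inr ℝ U V

/-- The upper left block of an operator on `U × V`. -/
def block11 (Q : Prod2 U V →L[ℝ] Prod2 U V) : U →L[ℝ] U :=
  WithLp.fstL 2 ℝ U V ∘L Q ∘L inl U V

/-- The upper right block of an operator on `U × V`. -/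
def block12 (Q : Prod2 U V →L[ℝ] Prod2 U V) : V →L[ℝ] U :=
  WithLp.fstL 2 ℝ U V ∘L Q ∘L inr U V

/-- The lower right block of an operator on `U × V`. -/
def block22 (Q : Prod2 U V →L[ℝ] Prod2 U V) : V →L[ℝ] V :=
  WithLp.sndL 2 ℝ U V ∘L Q ∘L inr U V

/-- The block diagonal operator `Diag(G₁, G₂)`, `(u, v) ↦ (G₁ u, G₂ v)`. -/
def blockDiag (G₁ : U →L[ℝ] U) (G₂ : V →L[ℝ] V) : Prod2 U V →L[ℝ] Prod2 U V :=
  inl U V ∘L G₁ ∘L WithLp.fstL 2 ℝ U V + inr U V ∘L G₂ ∘L WithLp.sndL 2 ℝ U V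

/-! ### Clarke's generalized Hessian -/

/-- Clarke's generalized Hessian `∂²φ(w)`: the convex hull of all limits of Hessians `∇²φ(zₖ)`
along sequences `zₖ → w` of points at which `∇φ` is differentiable. -/
def clarkeHessian (φ : E → ℝ) (w : E) : Set (E →L[ℝ] E) :=
  convexHull ℝ {W | ∃ z : ℕ → E, Tendsto z atTop (𝓝 w) ∧
    (∀ k, DifferentiableAt ℝ (gradient φ) (z k)) ∧
    Tendsto (fun k => fderiv ℝ (gradient φ) (z k)) atTop (𝓝 W)}

/-! ### The optimization problem -/

variable (U V X) in
/-- The data of the problem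
`min p(u) + q(v) + φ(u, v)` subject to `A* u + B* v = c`. -/
structure Problem where
  /-- the nonsmooth part in `u` -/
  p : U → EReal
  /-- the nonsmooth part in `v` -/
  q : V → EReal
  /-- the coupled smooth part -/
  φ : Prod2 U V → ℝ
  /-- the first constraint operator (its adjoint acts on `u`) -/
  A : X →L[ℝ] U
  /-- the second constraint operator (its adjoint acts on `v`) -/
  B : X →L[ℝ] V
  /-- the right-hand side -/
  c : X

namespace Problem

variable (P : Problem U V X)

/-- The adjoint of `A`. -/
def Aadj : U →L[ℝ] X := ContinuousLinearMap.adjoint P.A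

/-- The adjoint of `B`. -/
def Badj : V →L[ℝ] X := ContinuousLinearMap.adjoint P.B

/-- The constraint residual `A* u + B* v - c`. -/
def residual (u : U) (v : V) : X := P.Aadj u + P.Badj v - P.c

/-- The objective `θ(u, v) = p(u) + q(v) + φ(u, v)`. -/
def objective (u : U) (v : V) : EReal := P.p u + P.q v + (P.φ (pair u v) : EReal)

/-- The standing assumptions on the problem: `p`, `q` are closed proper convex and `φ` is
convex and differentiable with Lipschitz continuous gradient. -/
structure Standing : Prop where
  p_convex : IsClosedProperConvex P.p
  q_convex : IsClosedProperConvex P.q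
  φ_convex : ConvexOn ℝ Set.univ P.φ
  φ_differentiable : Differentiable ℝ P.φ
  φ_lipschitz : ∃ L, LipschitzWith L (gradient P.φ)

/-- `(u, v)` is an optimal solution: it is feasible and minimizes the objective
among all feasible points. -/
def IsSolution (u : U) (v : V) : Prop :=
  P.Aadj u + P.Badj v = P.c ∧
    ∀ u' v', P.Aadj u' + P.Badj v' = P.c → P.objective u v ≤ P.objective u' v'

/-- The constraint qualification: some feasible point lies in the relative interior of
`dom p × dom q`. -/
def ConstraintQualification : Prop :=
  ∃ u v, (u, v) ∈ intrinsicInterior ℝ (dom P.p ×ˢ dom P.q) ∧ P.Aadj u + P.Badj v = P.c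

/-- The Karush-Kuhn-Tucker system:
`0 ∈ ∂p(u) + ∇ᵤφ(u, v) + A x`, `0 ∈ ∂q(v) + ∇ᵥφ(u, v) + B x`, `A* u + B* v = c`.
Then `x` is called an optimal multiplier corresponding to `(u, v)`. -/
def IsKKT (u : U) (v : V) (x : X) : Prop :=
  (∃ ξ ∈ subdifferential P.p u, (gradient P.φ (pair u v)).fst + ξ + P.A x = 0) ∧
  (∃ ζ ∈ subdifferential P.q v, (gradient P.φ (pair u v)).snd + ζ + P.B x = 0) ∧
  P.Aadj u + P.Badj v = P.c

end Problem

/-! ### The majorized ADMM -/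

variable (U V) in
/-- The parameters of the majorized ADMM: the operators `Q`, `D₁`, `D₂` of the majorization,
the proximal operators `S`, `T`, the penalty parameter `σ` and the step length `τ`. -/
structure Params where
  /-- the lower bound of the generalized Hessians -/
  Q : Prod2 U V →L[ℝ] Prod2 U V
  /-- the first diagonal block of the gap `H` -/
  D₁ : U →L[ℝ] U
  /-- the second diagonal block of the gap `H` -/
  D₂ : V →L[ℝ] V
  /-- the proximal operator in `u` -/
  S : U →L[ℝ] U
  /-- the proximal operator in `v` -/
  T : V →L[ℝ] V
  /-- the penalty parameter -/
  σ : ℝ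
  /-- the step length -/
  τ : ℝ

namespace Params

variable (a : Params U V)

/-- The gap operator `H = Diag(D₁, D₂)`. -/
def H : Prod2 U V →L[ℝ] Prod2 U V := blockDiag a.D₁ a.D₂

/-- Admissible parameters: `σ, τ > 0`, all operators are self-adjoint positive semidefinite,
and `Q ⪯ W ⪯ Q + H` for all `W ∈ ∂²φ(w)` and all `w`. -/
structure Admissible (φ : Prod2 U V → ℝ) : Prop where
  σ_pos : 0 < a.σ
  τ_pos : 0 < a.τ
  Q_psd : a.Q.IsPositive
  D₁_psd : a.D₁.IsPositive
  D₂_psd : a.D₂.IsPositive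
  S_psd : a.S.IsPositive
  T_psd : a.T.IsPositive
  hessian_bounds : ∀ w, ∀ W ∈ clarkeHessian φ w,
    (W - a.Q).IsPositive ∧ (a.Q + a.H - W).IsPositive

/-- The constant `η ∈ [0, 1]` controls the off-diagonal blocks of the generalized Hessians:
`|⟨u, (W₁₂ - Q₁₂) v⟩| ≤ (η / 2) (‖u‖²_{D₁} + ‖v‖²_{D₂})`
for all `W` in any generalized Hessian of `φ` and all `u`, `v`. -/
def CrossControl (φ : Prod2 U V → ℝ) (η : ℝ) : Prop :=
  η ∈ Set.Icc (0 : ℝ) 1 ∧ ∀ w, ∀ W ∈ clarkeHessian φ w, ∀ (u : U) (v : V),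
    |inner ℝ u ((block12 W - block12 a.Q) v)| ≤ η / 2 * (normSq a.D₁ u + normSq a.D₂ v)

/-- The majorization of `φ` at `w'`:
`φ̂(w; w') = φ(w') + ⟨∇φ(w'), w - w'⟩ + ½ ‖w' - w‖²_{Q+H}`. -/
def majorant (φ : Prod2 U V → ℝ) (w w' : Prod2 U V) : ℝ :=
  φ w' + inner ℝ (gradient φ w') (w - w') + 1 / 2 * normSq (a.Q + a.H) (w' - w)

/-- The majorized augmented Lagrangian
`p(u) + q(v) + φ̂(w; w') + ⟨x, A* u + B* v - c⟩ + (σ/2) ‖A* u + B* v - c‖²`, `w = (u, v)`. -/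
def lagrangian (P : Problem U V X) (u : U) (v : V) (x : X) (w' : Prod2 U V) : EReal :=
  P.p u + P.q v + ((a.majorant P.φ (pair u v) w' + inner ℝ x (P.residual u v)
    + a.σ / 2 * ‖P.residual u v‖ ^ 2 : ℝ) : EReal)

/-- `(uᵏ, vᵏ, xᵏ)` is generated by the majorized ADMM. -/
structure IsGenerated (P : Problem U V X) (u : ℕ → U) (v : ℕ → V) (x : ℕ → X) : Prop where
  init_u : u 0 ∈ dom P.p
  init_v : v 0 ∈ dom P.q
  step_u : ∀ k, IsMinOn (fun u' => a.lagrangian P u' (v k) (x k) (pair (u k) (v k))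
    + ((1 / 2 * normSq a.S (u' - u k) : ℝ) : EReal)) Set.univ (u (k + 1))
  step_v : ∀ k, IsMinOn (fun v' => a.lagrangian P (u (k + 1)) v' (x k) (pair (u k) (v k))
    + ((1 / 2 * normSq a.T (v' - v k) : ℝ) : EReal)) Set.univ (v (k + 1))
  step_x : ∀ k, x (k + 1) = x k + (a.τ * a.σ) • P.residual (u (k + 1)) (v (k + 1))

/-- The operator `M = ¼ Q + Diag(S - η D₁, T - η D₂)`. -/
def M (η : ℝ) : Prod2 U V →L[ℝ] Prod2 U V :=
  (1 / 4 : ℝ) • a.Q + blockDiag (a.S - η • a.D₁) (a.T - η • a.D₂)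

end Params

/-- The sequence `(uᵏ, vᵏ)` converges to an optimal solution and `xᵏ` converges to a
corresponding optimal multiplier. -/
def ConvergesToSolution (P : Problem U V X) (u : ℕ → U) (v : ℕ → V) (x : ℕ → X) : Prop :=
  ∃ (ubar : U) (vbar : V) (xbar : X),
    P.IsSolution ubar vbar ∧ P.IsKKT ubar vbar xbar ∧
    Tendsto (fun k => (u k, v k)) atTop (𝓝 (ubar, vbar)) ∧ Tendsto x atTop (𝓝 xbar)

end MajorizedADMM

end

set_option linter.unusedSectionVars false

open Filter Topology

noncomputable section

namespace MajorizedADMM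

/-! ### A mean value theorem for Lipschitz maps -/

section MeanValue

open MeasureTheory

variable {E : Type*} [NormedAddCommGroup E] [InnerProductSpace ℝ E] [FiniteDimensional ℝ E]

/-! The nonsmooth terms enter through the monotonicity of their subdifferentials. The smooth term
enters through two consequences of the Hessian bounds. Increments of `∇φ` have the form `W (w - w')`
with `W` obeying those bounds (`exists_operator_gradient_sub`): derivatives are averaged along
segments, Rademacher and Fubini give almost every segment, compactness gives the others. Integration
then gives a lower quadratic bound with `Q` and an upper one with `Q + H`, combined in the
three-point inequality `inner_gradient_sub_ge`.

The constraint qualification turns a solution into a KKT point (`Problem.exists_isKKT`).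
Monotonicity of `∂p` and `∂q` between an iterate and that point gives `energy_descent`. The price
`½‖Δw‖²_H` of majorization is exactly what the quadratic terms in `D₁`, `D₂` of the subproblems
earn. Two terms without sign remain: `⟨u₁ - u', Q₁₂ Δv⟩`, because the `u`-step sees the old `v`, and
`⟨r, B* Δv⟩`, with `r` the new residual.

For `τ ≤ 1` completing squares disposes of both, at the cost of a telescoping `½ Q₂₂` term. For
larger `τ`, comparing consecutive `v`-steps (`inner_residual_le`) replaces `⟨r, B* Δv⟩` by `1 - τ`
times the same product with the previous residual, up to terms in `η`. `exists_residual_weights`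
absorbs this exactly while `1 + τ - τ² > 0`, and the increments are left with the form `½ M`.

In both regimes a merit function decreases by a summable gap. Hence the iterates are bounded, the
residuals vanish, and a quadratic form of the increments tends to zero. By hypothesis every cluster
point of the increments has a zero component; positive definiteness then forces the other component
to vanish. So cluster points of the iterates are KKT points, and re-centring the merit function at
one of them gives convergence of the whole sequence. -/

/-- For almost every `z`, the line `t ↦ z + t d` meets the points of differentiability of a
Lipschitz map at almost every time. -/
theorem ae_ae_differentiableAt_line [MeasurableSpace E] [BorelSpace E] {F : E → E}
    {C : NNReal} (hF : LipschitzWith C F) (d : E) :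
    ∀ᵐ z ∂(volume : Measure E), ∀ᵐ t ∂(volume : Measure ℝ), DifferentiableAt ℝ F (z + t • d) := by
  have hmeas : MeasurableSet {x : ℝ × E | DifferentiableAt ℝ F (x.2 + x.1 • d)} :=
    (measurableSet_of_differentiableAt ℝ F).preimage
      (f := fun x : ℝ × E => x.2 + x.1 • d) (by fun_prop)
  -- For fixed `t` this is Rademacher's theorem after a translation; Fubini exchanges the order of
  -- `t` and `z`.
  have h1 : ∀ᵐ x ∂((volume : Measure ℝ).prod (volume : Measure E)),
      DifferentiableAt ℝ F (x.2 + x.1 • d) := by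
    rw [Measure.ae_prod_iff_ae_ae hmeas]
    refine Eventually.of_forall fun t => ?_
    have h2 := hF.ae_differentiableAt (μ := (volume : Measure E))
    exact (measurePreserving_add_right (volume : Measure E) (t • d)).quasiMeasurePreserving.ae h2
  exact Measure.ae_ae_comm hmeas |>.1 (Measure.ae_ae_of_ae_prod h1)

/-- The operator is the average of the derivative over the segment, which stays in `K` because `K`
is closed and convex. The norm bound is recorded for the compactness argument that later removes the
assumption on `z`. -/
theorem exists_mem_sub_eq_of_ae_line [MeasurableSpace E] [BorelSpace E] {F : E → E}
    {C : NNReal} (hF : LipschitzWith C F) {K : Set (E →L[ℝ] E)} (hKc : Convex ℝ K)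
    (hKcl : IsClosed K) (hK : ∀ z, DifferentiableAt ℝ F z → fderiv ℝ F z ∈ K) (z d : E)
    (hz : ∀ᵐ t ∂(volume : Measure ℝ), DifferentiableAt ℝ F (z + t • d)) :
    ∃ W ∈ K, ‖W‖ ≤ C ∧ F (z + d) - F z = W d := by
  set μ : Measure ℝ := volume.restrict (Set.Ioc (0 : ℝ) 1) with hμ
  have : IsProbabilityMeasure μ := ⟨by simp [hμ]⟩
  set W : ℝ → (E →L[ℝ] E) := fun t => fderiv ℝ F (z + t • d) with hW
  have hzμ : ∀ᵐ t ∂μ, DifferentiableAt ℝ F (z + t • d) := ae_restrict_of_ae hz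
  have hWmeas : Measurable W := (measurable_fderiv ℝ F).comp (by fun_prop)
  have hbd : ∀ t, ‖W t‖ ≤ C := fun t => norm_fderiv_le_of_lipschitz ℝ hF
  have hint : Integrable W μ :=
    Integrable.of_bound hWmeas.aestronglyMeasurable C (Eventually.of_forall hbd)
  refine ⟨∫ t, W t ∂μ, hKc.integral_mem hKcl (hzμ.mono fun t ht => hK _ ht) hint, ?_, ?_⟩
  · refine (norm_integral_le_integral_norm _).trans ?_
    calc ∫ t, ‖W t‖ ∂μ ≤ ∫ _t, (C : ℝ) ∂μ :=
          integral_mono hint.norm (integrable_const _) hbd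
      _ = C := by simp
  -- Each scalar component along the segment is Lipschitz, hence absolutely continuous, so the
  -- fundamental theorem of calculus applies although the derivative exists only almost everywhere.
  · refine ext_inner_left ℝ fun ξ => ?_
    have hline : LipschitzWith (C * ‖d‖₊) fun t : ℝ => F (z + t • d) := by
      refine hF.comp (LipschitzWith.of_dist_le_mul fun s t => ?_)
      rw [dist_add_left, dist_eq_norm, ← sub_smul, norm_smul, mul_comm]
      rfl
    have hg : LipschitzWith (‖innerSL ℝ ξ‖₊ * (C * ‖d‖₊))
        fun t : ℝ => inner ℝ ξ (F (z + t • d)) :=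
      (innerSL ℝ ξ).lipschitz.comp hline
    have hac : AbsolutelyContinuousOnInterval (fun t : ℝ => inner ℝ ξ (F (z + t • d))) 0 1 :=
      (hg.lipschitzOnWith).absolutelyContinuousOnInterval
    have hftc := hac.integral_deriv_eq_sub
    have hderiv : ∀ᵐ t ∂μ, deriv (fun t : ℝ => inner ℝ ξ (F (z + t • d))) t
        = inner ℝ ξ (W t d) := by
      filter_upwards [hzμ] with t ht
      have h1 : HasDerivAt (fun t : ℝ => z + t • d) d t := by
        simpa using ((hasDerivAt_id t).smul_const d).const_add z
      have h2 : HasDerivAt (fun t : ℝ => F (z + t • d)) (W t d) t :=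
        HasFDerivAt.comp_hasDerivAt t (f := fun t : ℝ => z + t • d) ht.hasFDerivAt h1
      exact (((innerSL ℝ ξ).hasFDerivAt).comp_hasDerivAt t h2).deriv
    rw [intervalIntegral.integral_of_le zero_le_one, integral_congr_ae hderiv] at hftc
    rw [ContinuousLinearMap.integral_apply hint, ← integral_inner (hint.apply_continuousLinearMap d),
      hftc, inner_sub_right]
    simp

/-- Mean value theorem: if the derivatives of a Lipschitz map lie in a closed convex set `K`
wherever they exist, then each increment `F w - F w'` is `W (w - w')` for some `W ∈ K`. -/
theorem exists_mem_sub_eq_of_lipschitz {F : E → E}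
    {C : NNReal} (hF : LipschitzWith C F) {K : Set (E →L[ℝ] E)} (hKc : Convex ℝ K)
    (hKcl : IsClosed K) (hK : ∀ z, DifferentiableAt ℝ F z → fderiv ℝ F z ∈ K) (w w' : E) :
    ∃ W ∈ K, F w - F w' = W (w - w') := by
  borelize E
  set d := w - w' with hd
  -- A set of full measure is dense; the uniformly bounded operators found at base points near `w'`
  -- subconverge, and the identity passes to the limit.
  have hdense : Dense {z : E | ∃ W ∈ K, ‖W‖ ≤ C ∧ F (z + d) - F z = W d} :=
    Measure.dense_of_ae ((ae_ae_differentiableAt_line hF d).mono fun z hz =>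
      exists_mem_sub_eq_of_ae_line hF hKc hKcl hK z d hz)
  obtain ⟨z, hz, hlim⟩ := mem_closure_iff_seq_limit.1 (hdense w')
  choose W hWK hWC hWd using hz
  obtain ⟨W', -, φ, hφ, hW'⟩ := (isCompact_closedBall (0 : E →L[ℝ] E) C).tendsto_subseq
    (x := W) fun n => by simpa using hWC n
  refine ⟨W', hKcl.mem_of_tendsto hW' (Eventually.of_forall fun n => hWK _), ?_⟩
  have hz' := hlim.comp hφ.tendsto_atTop
  have h1 : Tendsto (fun n => F (z (φ n) + d) - F (z (φ n))) atTop (𝓝 (F (w' + d) - F w')) :=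
    ((hF.continuous.tendsto _).comp (hz'.add_const d)).sub ((hF.continuous.tendsto _).comp hz')
  have h2 : Tendsto (fun n => W (φ n) d) atTop (𝓝 (W' d)) :=
    ((ContinuousLinearMap.apply ℝ E d).continuous.tendsto W').comp hW'
  have h3 := tendsto_nhds_unique h1 (h2.congr fun n => (hWd (φ n)).symm)
  rwa [hd, add_sub_cancel] at h3

end MeanValue

/-! ### Convex analysis -/

section Convex

variable {E X : Type*}
  [NormedAddCommGroup E] [InnerProductSpace ℝ E]
  [NormedAddCommGroup X] [InnerProductSpace ℝ X] [FiniteDimensional ℝ X]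

namespace IsClosedProperConvex

variable {f : E → EReal}

theorem coe_toReal (hf : IsClosedProperConvex f) {x : E} (hx : x ∈ dom f) :
    ((f x).toReal : EReal) = f x :=
  EReal.coe_toReal (ne_of_lt hx) (hf.ne_bot x)

theorem combination_le (hf : IsClosedProperConvex f) {x y : E} (hx : x ∈ dom f) (hy : y ∈ dom f)
    {a b : ℝ} (ha : 0 ≤ a) (hb : 0 ≤ b) (hab : a + b = 1) :
    f (a • x + b • y) ≤ ((a * (f x).toReal + b * (f y).toReal : ℝ) : EReal) := by
  have h := hf.convex_epigraph (x := (x, (f x).toReal)) (y := (y, (f y).toReal))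
    (by simp [hf.coe_toReal hx]) (by simp [hf.coe_toReal hy]) ha hb hab
  simpa using h

theorem convexOn_toReal (hf : IsClosedProperConvex f) :
    ConvexOn ℝ (dom f) fun x => (f x).toReal := by
  have hdom : Convex ℝ (dom f) := fun x hx y hy a b ha hb hab =>
    (hf.combination_le hx hy ha hb hab).trans_lt (EReal.coe_lt_top _)
  refine ⟨hdom, fun x hx y hy a b ha hb hab => ?_⟩
  have h := hf.combination_le hx hy ha hb hab
  rw [← hf.coe_toReal (hdom hx hy ha hb hab)] at h
  exact_mod_cast h

theorem mem_dom_of_mem_subdifferential (hf : IsClosedProperConvex f) {x ξ : E}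
    (h : ξ ∈ subdifferential f x) : x ∈ dom f := by
  obtain ⟨y, hy⟩ := hf.dom_nonempty
  by_contra hx
  have hx' : f x = ⊤ := not_lt_top_iff.1 hx
  have := h y
  rw [hx', EReal.top_add_coe] at this
  exact absurd hy (not_lt.2 this)

theorem mem_subdifferential_iff (hf : IsClosedProperConvex f) {x ξ : E} (hx : x ∈ dom f) :
    ξ ∈ subdifferential f x ↔
      ∀ y ∈ dom f, (f x).toReal + inner ℝ ξ (y - x) ≤ (f y).toReal := by
  refine ⟨fun h y hy => ?_, fun h y => ?_⟩
  · have := h y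
    rw [← hf.coe_toReal hx, ← hf.coe_toReal hy] at this
    exact_mod_cast this
  · by_cases hy : y ∈ dom f
    · rw [← hf.coe_toReal hx, ← hf.coe_toReal hy]
      exact_mod_cast h y hy
    · rw [show f y = ⊤ from not_lt_top_iff.1 hy]
      exact le_top

theorem inner_subgradient_nonneg (hf : IsClosedProperConvex f) {x y ξ ζ : E}
    (hξ : ξ ∈ subdifferential f x) (hζ : ζ ∈ subdifferential f y) :
    0 ≤ inner ℝ (ξ - ζ) (x - y) := by
  have hx := hf.mem_dom_of_mem_subdifferential hξ
  have hy := hf.mem_dom_of_mem_subdifferential hζ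
  have h1 := (hf.mem_subdifferential_iff hx).1 hξ y hy
  have h2 := (hf.mem_subdifferential_iff hy).1 hζ x hx
  have h3 : inner ℝ ξ (y - x) = - inner ℝ ξ (x - y) := by rw [← inner_neg_right, neg_sub]
  rw [inner_sub_left]
  linarith

/-- The graph of the subdifferential is closed. -/
theorem mem_subdifferential_of_tendsto (hf : IsClosedProperConvex f) {x ξ : ℕ → E} {x' ξ' : E}
    (hx : Tendsto x atTop (𝓝 x')) (hξ : Tendsto ξ atTop (𝓝 ξ'))
    (h : ∀ n, ξ n ∈ subdifferential f (x n)) : ξ' ∈ subdifferential f x' := by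
  -- Stated in `EReal` because `x' ∈ dom f` is not yet known: lower semicontinuity gives this bound,
  -- and one finite `f y` then gives membership.
  have key : ∀ y ∈ dom f, f x' ≤ (((f y).toReal - inner ℝ ξ' (y - x') : ℝ) : EReal) := by
    intro y hy
    have hlim : Tendsto (fun n => (f y).toReal - inner ℝ (ξ n) (y - x n)) atTop
        (𝓝 ((f y).toReal - inner ℝ ξ' (y - x'))) :=
      tendsto_const_nhds.sub (hξ.inner (tendsto_const_nhds.sub hx))
    refine le_of_forall_lt fun c hc => ?_
    obtain ⟨c', hcc', hc'⟩ := exists_between hc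
    have h1 : ∀ᶠ n in atTop, c' < f (x n) := hx.eventually (hf.lowerSemicontinuous x' c' hc')
    have h2 : ∀ᶠ n in atTop, c' ≤ (((f y).toReal - inner ℝ (ξ n) (y - x n) : ℝ) : EReal) := by
      filter_upwards [h1] with n hn
      have hxn := hf.mem_dom_of_mem_subdifferential (h n)
      have h3 := (hf.mem_subdifferential_iff hxn).1 (h n) y hy
      rw [← hf.coe_toReal hxn] at hn
      refine hn.le.trans (EReal.coe_le_coe_iff.2 ?_)
      linarith
    exact hcc'.trans_le
      (ge_of_tendsto ((continuous_coe_real_ereal.tendsto _).comp hlim) h2)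
  obtain ⟨y₀, hy₀⟩ := hf.dom_nonempty
  have hx' : x' ∈ dom f := (key y₀ hy₀).trans_lt (EReal.coe_lt_top _)
  refine (hf.mem_subdifferential_iff hx').2 fun y hy => ?_
  have := key y hy
  rw [← hf.coe_toReal hx', EReal.coe_le_coe_iff] at this
  linarith

end IsClosedProperConvex

/-- Divide by `t` and let `t → 0`. This converts minimality along a segment into a first order
inequality. -/
theorem nonneg_of_forall_small {a C : ℝ} (h : ∀ t : ℝ, 0 < t → t ≤ 1 → 0 ≤ t * a + t ^ 2 * C) :
    0 ≤ a := by
  have h1 : Tendsto (fun t : ℝ => a + t * C) (𝓝[>] 0) (𝓝 (a + 0 * C)) :=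
    ((continuous_const.add (continuous_id.mul continuous_const)).tendsto (0 : ℝ)).mono_left
      nhdsWithin_le_nhds
  rw [zero_mul, add_zero] at h1
  refine ge_of_tendsto h1 ?_
  filter_upwards [Ioc_mem_nhdsGT (zero_lt_one (α := ℝ))] with t ht
  have h2 := h t ht.1 ht.2
  have h3 : 0 ≤ t * (a + t * C) := by linarith
  exact nonneg_of_mul_nonneg_right h3 ht.1

/-- First order condition: linearizing the smooth part `h` of a sum `F + h` minimized over a
convex set keeps the minimizer. -/
theorem linearized_minimizer {K : Set E} {F h : E → ℝ} (hF : ConvexOn ℝ K F) {x g : E}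
    (hx : x ∈ K) (hg : ∀ d, ∃ C, ∀ t : ℝ, 0 < t → t ≤ 1 →
      h (x + t • d) ≤ h x + t * inner ℝ g d + t ^ 2 * C)
    {y : E} (hy : y ∈ K) (hmin : ∀ t : ℝ, 0 < t → t ≤ 1 →
      F x + h x ≤ F (x + t • (y - x)) + h (x + t • (y - x))) :
    F x ≤ F y + inner ℝ g (y - x) := by
  obtain ⟨C, hC⟩ := hg (y - x)
  have key : 0 ≤ F y - F x + inner ℝ g (y - x) := by
    refine nonneg_of_forall_small (C := C) fun t ht ht1 => ?_
    have h1 := hmin t ht ht1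
    have h2 := hC t ht ht1
    have h3 := hF.2 hx hy (sub_nonneg.2 ht1) ht.le (sub_add_cancel 1 t)
    rw [show (1 - t) • x + t • y = x + t • (y - x) by module] at h3
    simp only [smul_eq_mul] at h3
    nlinarith
  linarith

/-- Only an upper quadratic bound of slope `g` along rays is asked of `h`, which the quadratic
subproblems supply as an identity. -/
theorem IsClosedProperConvex.neg_mem_subdifferential_of_isMinOn {f : E → EReal}
    (hf : IsClosedProperConvex f) {h : E → ℝ} {x g : E}
    (hmin : ∀ y, f x + (h x : EReal) ≤ f y + (h y : EReal))
    (hg : ∀ d, ∃ C, ∀ t : ℝ, 0 < t → t ≤ 1 →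
      h (x + t • d) ≤ h x + t * inner ℝ g d + t ^ 2 * C) :
    -g ∈ subdifferential f x := by
  have hx : x ∈ dom f := by
    obtain ⟨y, hy⟩ := hf.dom_nonempty
    by_contra hx
    have h1 := hmin y
    rw [show f x = ⊤ from not_lt_top_iff.1 hx, EReal.top_add_coe, ← hf.coe_toReal hy,
      ← EReal.coe_add] at h1
    exact absurd (EReal.coe_lt_top _) (not_lt.2 h1)
  refine (hf.mem_subdifferential_iff hx).2 fun y hy => ?_
  have h1 := linearized_minimizer hf.convexOn_toReal hx hg hy fun t ht ht1 => by
    have hmem : x + t • (y - x) ∈ dom f := by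
      have := hf.convexOn_toReal.1 hx hy (sub_nonneg.2 ht1) ht.le (sub_add_cancel 1 t)
      rwa [show (1 - t) • x + t • y = x + t • (y - x) by module] at this
    have := hmin (x + t • (y - x))
    rw [← hf.coe_toReal hx, ← hf.coe_toReal hmem] at this
    exact_mod_cast this
  rw [inner_neg_left]
  linarith

/-- A convex set can be prolonged beyond a relative interior point. -/
theorem exists_prolongation_of_mem_intrinsicInterior {F : Type*} [NormedAddCommGroup F]
    [NormedSpace ℝ F] {K : Set F} {x y : F} (hx : x ∈ intrinsicInterior ℝ K) (hy : y ∈ K) :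
    ∃ ε : ℝ, 0 < ε ∧ x - ε • (y - x) ∈ K := by
  obtain ⟨x', hx', rfl⟩ := mem_intrinsicInterior.1 hx
  have hyA : y ∈ affineSpan ℝ K := subset_affineSpan ℝ K hy
  have hmem : ∀ t : ℝ, (x' : F) - t • (y - x') ∈ affineSpan ℝ K := fun t => by
    have := AffineMap.lineMap_mem (-t) x'.2 hyA
    rw [AffineMap.lineMap_apply_module'] at this
    convert this using 1
    module
  -- The line through `x` and `y` stays in the affine span, and `K` contains a neighbourhood of `x`
  -- there, so small steps away from `y` remain in `K`.
  let γ : ℝ → affineSpan ℝ K := fun t => ⟨(x' : F) - t • (y - x'), hmem t⟩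
  have hγ : Continuous γ := by fun_prop
  have hγ0 : γ 0 = x' := by ext; simp [γ]
  have h1 : ∀ᶠ t in 𝓝 (0 : ℝ), γ t ∈ interior ((↑) ⁻¹' K : Set (affineSpan ℝ K)) :=
    hγ.continuousAt.eventually_mem (isOpen_interior.mem_nhds (by rwa [hγ0]))
  have h2 : ∀ᶠ t in 𝓝[>] (0 : ℝ), γ t ∈ interior ((↑) ⁻¹' K : Set (affineSpan ℝ K)) :=
    h1.filter_mono nhdsWithin_le_nhds
  obtain ⟨ε, hε, hε0⟩ := (h2.and self_mem_nhdsWithin).exists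
  exact ⟨ε, hε0, (interior_subset hε : γ ε ∈ _)⟩

/-- Lagrange multipliers for a convex problem with affine constraints under a relative interior
constraint qualification. -/
theorem exists_multiplier {F : Type*} [AddCommGroup F] [Module ℝ F] {K : Set F} {f : F → ℝ}
    (hf : ConvexOn ℝ K f) (L : F →ₗ[ℝ] X) {c : X} {m : ℝ} {w₀ : F} (hw₀ : w₀ ∈ K)
    (hLw₀ : L w₀ = c) (hri : ∀ w ∈ K, ∃ ε : ℝ, 0 < ε ∧ w₀ - ε • (w - w₀) ∈ K)
    (hm : ∀ w ∈ K, L w = c → m ≤ f w) :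
    ∃ x : X, ∀ w ∈ K, m ≤ f w + inner ℝ x (L w - c) := by
  -- Convexity keeps nonnegative combinations of the vectors `L w - c` on rays of the same kind,
  -- with the excesses `f w - m` subadditive. Both the span description and the cone below rest on
  -- this.
  have hcomb : ∀ {a b : ℝ} {w w' : F}, 0 ≤ a → 0 ≤ b → w ∈ K → w' ∈ K →
      ∃ w'' ∈ K, a • (L w - c) + b • (L w' - c) = (a + b) • (L w'' - c) ∧
        (a + b) * (f w'' - m) ≤ a * (f w - m) + b * (f w' - m) := by
    intro a b w w' ha hb hw hw'
    rcases (add_nonneg ha hb).eq_or_lt with h0 | hpos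
    · have ha0 : a = 0 := by linarith
      have hb0 : b = 0 := by linarith
      exact ⟨w, hw, by simp [ha0, hb0], by simp [ha0, hb0]⟩
    · have hs : a / (a + b) + b / (a + b) = 1 := by field_simp
      have hane : (a + b) * (a / (a + b)) = a := by field_simp
      have hbne : (a + b) * (b / (a + b)) = b := by field_simp
      refine ⟨_, hf.1 hw hw' (div_nonneg ha hpos.le) (div_nonneg hb hpos.le) hs, ?_, ?_⟩
      · rw [map_add, map_smul, map_smul, smul_sub (a + b), smul_add, smul_smul, smul_smul, hane,
          hbne]
        module
      · have h1 := mul_le_mul_of_nonneg_left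
          (hf.2 hw hw' (div_nonneg ha hpos.le) (div_nonneg hb hpos.le) hs) hpos.le
        simp only [smul_eq_mul] at h1
        rw [mul_add, ← mul_assoc, ← mul_assoc, hane, hbne] at h1
        linarith
  let Y : Submodule ℝ X := Submodule.span ℝ ((fun w => L w - c) '' K)
  have hY : ∀ y ∈ Y, ∃ l : ℝ, 0 ≤ l ∧ ∃ w ∈ K, y = l • (L w - c) := by
    intro y hy
    induction hy using Submodule.span_induction with
    | mem y hy =>
      obtain ⟨w, hw, rfl⟩ := hy
      exact ⟨1, zero_le_one, w, hw, by simp⟩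
    | zero => exact ⟨0, le_rfl, w₀, hw₀, by simp⟩
    | add y z _ _ hy hz =>
      obtain ⟨a, ha, w, hw, rfl⟩ := hy
      obtain ⟨b, hb, w', hw', rfl⟩ := hz
      obtain ⟨w'', hw'', h, -⟩ := hcomb ha hb hw hw'
      exact ⟨a + b, add_nonneg ha hb, w'', hw'', h⟩
    | smul r y _ hy =>
      obtain ⟨a, ha, w, hw, rfl⟩ := hy
      rcases le_total 0 r with hr | hr
      · exact ⟨r * a, mul_nonneg hr ha, w, hw, smul_smul _ _ _⟩
      -- Prolonging from `w` beyond `w₀` produces the image `-ε (L w - c)`, so negative multiples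
      -- are again nonnegative ones. This is where the relative interior enters.
      · obtain ⟨ε, hε, hmem⟩ := hri w hw
        refine ⟨-r * a / ε, div_nonneg (mul_nonneg (neg_nonneg.2 hr) ha) hε.le, _, hmem, ?_⟩
        rw [map_sub, map_smul, map_sub, hLw₀,
          show c - ε • (L w - c) - c = (-ε) • (L w - c) by module, smul_smul, smul_smul]
        congr 1
        field_simp
  -- Cone of constraint violations paired with values above the excess. Optimality makes the
  -- vertical coordinate nonnegative on its part over `0`; extending that functional by M. Riesz
  -- gives the multiplier as the slope in `Y`. Working in `Y` rather than `X` makes every point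
  -- reach the cone after a vertical shift.
  let s : PointedCone ℝ (Y × ℝ) :=
    { carrier := {z | ∃ l : ℝ, 0 ≤ l ∧ ∃ w ∈ K, (z.1 : X) = l • (L w - c) ∧ l * (f w - m) ≤ z.2}
      zero_mem' := ⟨0, le_rfl, w₀, hw₀, by simp, by simp⟩
      add_mem' := by
        rintro z z' ⟨a, ha, w, hw, h1, h2⟩ ⟨b, hb, w', hw', h1', h2'⟩
        obtain ⟨w'', hw'', h3, h4⟩ := hcomb ha hb hw hw'
        refine ⟨a + b, add_nonneg ha hb, w'', hw'', ?_, ?_⟩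
        · rw [← h3, ← h1, ← h1']; rfl
        · exact h4.trans (add_le_add h2 h2')
      smul_mem' := by
        rintro r z ⟨a, ha, w, hw, h1, h2⟩
        refine ⟨r * a, mul_nonneg r.2 ha, w, hw, ?_, ?_⟩
        · rw [mul_smul, ← h1]; rfl
        · rw [mul_assoc]
          exact mul_le_mul_of_nonneg_left h2 r.2 }
  let f₀ : (Y × ℝ) →ₗ.[ℝ] ℝ :=
    { domain := Submodule.prod ⊥ ⊤
      toFun := LinearMap.snd ℝ Y ℝ ∘ₗ Submodule.subtype _ }
  obtain ⟨g, hg, hgs⟩ := riesz_extension s f₀ (by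
      rintro ⟨⟨y, t⟩, hy⟩ ⟨l, hl, w, hw, h1, h2⟩
      change 0 ≤ t
      have hy0 : y = 0 := hy.1
      change (y : X) = _ at h1
      rw [hy0] at h1
      refine le_trans ?_ h2
      rcases hl.eq_or_lt with rfl | hpos
      · simp
      · have h3 : L w - c = 0 := by
          rcases smul_eq_zero.1 h1.symm with h | h
          · exact absurd h hpos.ne'
          · exact h
        exact mul_nonneg hl (sub_nonneg.2 (hm w hw (sub_eq_zero.1 h3)))) (by
      rintro ⟨y, r⟩
      obtain ⟨l, hl, w, hw, h⟩ := hY y y.2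
      exact ⟨⟨(0, l * (f w - m) - r), by simp [f₀, Submodule.mem_prod]⟩, l, hl, w, hw,
        by simpa using h, by simp⟩)
  let φ : Y →ₗ[ℝ] ℝ := g ∘ₗ LinearMap.inl ℝ Y ℝ
  let x : Y := (InnerProductSpace.toDual ℝ Y).symm (LinearMap.toContinuousLinearMap φ)
  have hx : ∀ y : Y, inner ℝ (x : X) (y : X) = g (y, 0) := fun y => by
    rw [← Submodule.coe_inner]
    simp [x, φ]
  refine ⟨x, fun w hw => ?_⟩
  have hwY : L w - c ∈ Y := Submodule.subset_span ⟨w, hw, rfl⟩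
  have h1 : 0 ≤ g (⟨L w - c, hwY⟩, f w - m) :=
    hgs _ ⟨1, zero_le_one, w, hw, by simp, by simp⟩
  have h2 : g ((0 : Y), f w - m) = f w - m :=
    hg ⟨((0 : Y), f w - m), by simp [f₀, Submodule.mem_prod]⟩
  have h3 : ((⟨L w - c, hwY⟩ : Y), f w - m) = (⟨L w - c, hwY⟩, (0 : ℝ)) + ((0 : Y), f w - m) := by
    simp
  rw [h3, map_add, h2, ← hx ⟨L w - c, hwY⟩] at h1
  change 0 ≤ inner ℝ (x : X) (L w - c) + (f w - m) at h1
  linarith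

end Convex

/-! ### Quadratic forms and block operators -/

section Operators

variable {E : Type*} [NormedAddCommGroup E] [InnerProductSpace ℝ E]

theorem inner_symm_of_isSymmetric {G : E →L[ℝ] E} (hG : G.IsSymmetric) (x y : E) :
    inner ℝ x (G y) = inner ℝ y (G x) := by
  rw [real_inner_comm]
  exact hG y x

theorem normSq_add {G : E →L[ℝ] E} (hG : G.IsSymmetric) (x y : E) :
    normSq G (x + y) = normSq G x + 2 * inner ℝ x (G y) + normSq G y := by
  simp only [normSq, map_add, inner_add_left, inner_add_right]
  rw [inner_symm_of_isSymmetric hG y x]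
  ring

theorem normSq_sub {G : E →L[ℝ] E} (hG : G.IsSymmetric) (x y : E) :
    normSq G (x - y) = normSq G x - 2 * inner ℝ x (G y) + normSq G y := by
  simp only [normSq, map_sub, inner_sub_left, inner_sub_right]
  rw [inner_symm_of_isSymmetric hG y x]
  ring

theorem normSq_smul (G : E →L[ℝ] E) (t : ℝ) (x : E) : normSq G (t • x) = t ^ 2 * normSq G x := by
  simp only [normSq, map_smul, inner_smul_left, inner_smul_right]
  simp
  ring

theorem normSq_neg (G : E →L[ℝ] E) (x : E) : normSq G (-x) = normSq G x := by
  simp [normSq]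

@[simp] theorem normSq_zero (G : E →L[ℝ] E) : normSq G 0 = 0 := by simp [normSq]

theorem normSq_nonneg {G : E →L[ℝ] E} (hG : G.IsPositive) (x : E) : 0 ≤ normSq G x :=
  hG.inner_nonneg_right x

theorem continuous_normSq (G : E →L[ℝ] E) : Continuous (normSq G) := by
  unfold normSq
  fun_prop

theorem normSq_le_of_isPositive_sub {G G' : E →L[ℝ] E} (h : (G - G').IsPositive) (x : E) :
    normSq G' x ≤ normSq G x := by
  have := normSq_nonneg h x
  simp only [normSq, sub_apply, inner_sub_right] at this
  simpa [normSq] using this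

/-- Young's inequality for the semi-inner product of a positive operator. -/
theorem two_mul_inner_le {G : E →L[ℝ] E} (hG : G.IsPositive) (x y : E) :
    2 * inner ℝ x (G y) ≤ normSq G x + normSq G y := by
  have := normSq_nonneg hG (x - y)
  rw [normSq_sub hG.isSymmetric] at this
  linarith

theorem isClosed_setOf_isPositive : IsClosed {G : E →L[ℝ] E | G.IsPositive} := by
  have h : {G : E →L[ℝ] E | G.IsPositive} =
      (⋂ x, ⋂ y, {G : E →L[ℝ] E | inner ℝ (G x) y = inner ℝ x (G y)}) ∩
        ⋂ x, {G : E →L[ℝ] E | 0 ≤ inner ℝ (G x) x} := by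
    ext G
    simp [ContinuousLinearMap.isPositive_iff, LinearMap.IsSymmetric]
  rw [h]
  refine (isClosed_iInter fun x => isClosed_iInter fun y => ?_).inter (isClosed_iInter fun x => ?_)
  · exact isClosed_eq (by fun_prop) (by fun_prop)
  · exact isClosed_le (by fun_prop) (by fun_prop)

end Operators

section Pairs

variable {U V : Type*} [NormedAddCommGroup U] [NormedAddCommGroup V]

theorem pair_add (a s : U) (b t : V) : pair (a + s) (b + t) = pair a b + pair s t := rfl

theorem pair_sub (a s : U) (b t : V) : pair (a - s) (b - t) = pair a b - pair s t := rfl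

theorem pair_eq_add (s : U) (t : V) : pair s t = pair s 0 + pair 0 t := by
  rw [← pair_add, add_zero, zero_add]

end Pairs

section Blocks

variable {U V : Type*}
  [NormedAddCommGroup U] [InnerProductSpace ℝ U] [NormedAddCommGroup V] [InnerProductSpace ℝ V]

theorem inner_pair (a s : U) (b t : V) :
    inner ℝ (pair a b) (pair s t) = inner ℝ a s + inner ℝ b t := rfl

theorem inner_pair_left (a : U) (b : V) (z : Prod2 U V) :
    inner ℝ (pair a b) z = inner ℝ a z.fst + inner ℝ b z.snd := rfl

theorem inner_pair_right (a : U) (b : V) (z : Prod2 U V) :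
    inner ℝ z (pair a b) = inner ℝ z.fst a + inner ℝ z.snd b := rfl

theorem fst_apply_pair (Q : Prod2 U V →L[ℝ] Prod2 U V) (s : U) (t : V) :
    (Q (pair s t)).fst = block11 Q s + block12 Q t := by
  rw [pair_eq_add, map_add]
  rfl

/-- For symmetric `Q` the lower left block is the transpose of `block12`, so a fourth block is never
needed. -/
theorem inner_apply_pair {Q : Prod2 U V →L[ℝ] Prod2 U V} (hQ : Q.IsSymmetric)
    (a s : U) (b t : V) :
    inner ℝ (pair a b) (Q (pair s t)) = inner ℝ a (block11 Q s) + inner ℝ a (block12 Q t)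
      + inner ℝ s (block12 Q b) + inner ℝ b (block22 Q t) := by
  have h1 : ∀ (a : U) (t : V), inner ℝ (pair a 0) (Q (pair 0 t)) = inner ℝ a (block12 Q t) := by
    intro a t
    rw [inner_pair_left, inner_zero_left, add_zero]
    rfl
  have h2 : inner ℝ (pair a (0 : V)) (Q (pair s 0)) = inner ℝ a (block11 Q s) := by
    rw [inner_pair_left, inner_zero_left, add_zero]
    rfl
  have h3 : inner ℝ (pair (0 : U) b) (Q (pair 0 t)) = inner ℝ b (block22 Q t) := by
    rw [inner_pair_left, inner_zero_left, zero_add]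
    rfl
  rw [pair_eq_add a b, pair_eq_add s t, map_add, inner_add_left, inner_add_right, inner_add_right,
    h1, h2, h3, inner_symm_of_isSymmetric hQ (pair 0 b), h1]
  ring

theorem normSq_pair {Q : Prod2 U V →L[ℝ] Prod2 U V} (hQ : Q.IsSymmetric) (a : U) (b : V) :
    normSq Q (pair a b) = normSq (block11 Q) a + 2 * inner ℝ a (block12 Q b)
      + normSq (block22 Q) b := by
  rw [normSq, inner_apply_pair hQ, normSq, normSq]
  ring

theorem blockDiag_apply (G₁ : U →L[ℝ] U) (G₂ : V →L[ℝ] V) (s : U) (t : V) :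
    blockDiag G₁ G₂ (pair s t) = pair (G₁ s) (G₂ t) := by
  change pair (G₁ s) 0 + pair 0 (G₂ t) = _
  rw [← pair_eq_add]

theorem normSq_blockDiag (G₁ : U →L[ℝ] U) (G₂ : V →L[ℝ] V) (s : U) (t : V) :
    normSq (blockDiag G₁ G₂) (pair s t) = normSq G₁ s + normSq G₂ t := by
  rw [normSq, blockDiag_apply, inner_pair]
  rfl

theorem isSymmetric_blockDiag {G₁ : U →L[ℝ] U} {G₂ : V →L[ℝ] V} (h₁ : G₁.IsSymmetric)
    (h₂ : G₂.IsSymmetric) : (blockDiag G₁ G₂).IsSymmetric := by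
  intro x y
  change inner ℝ (blockDiag G₁ G₂ (pair x.fst x.snd)) (pair y.fst y.snd)
    = inner ℝ (pair x.fst x.snd) (blockDiag G₁ G₂ (pair y.fst y.snd))
  rw [blockDiag_apply, blockDiag_apply, inner_pair, inner_pair]
  exact congrArg₂ (· + ·) (h₁ _ _) (h₂ _ _)

theorem normSq_block11 (Q : Prod2 U V →L[ℝ] Prod2 U V) (a : U) :
    normSq (block11 Q) a = normSq Q (pair a 0) := by
  rw [normSq, normSq, inner_pair_left, inner_zero_left, add_zero]
  rfl

theorem normSq_block22 (Q : Prod2 U V →L[ℝ] Prod2 U V) (b : V) :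
    normSq (block22 Q) b = normSq Q (pair 0 b) := by
  rw [normSq, normSq, inner_pair_left, inner_zero_left, zero_add]
  rfl

theorem isPositive_block22 {Q : Prod2 U V →L[ℝ] Prod2 U V} (hQ : Q.IsPositive) :
    (block22 Q).IsPositive := by
  have hin : ∀ b t : V, inner ℝ b (block22 Q t) = inner ℝ (pair 0 b) (Q (pair 0 t)) := by
    intro b t
    rw [inner_pair_left, inner_zero_left, zero_add]
    rfl
  refine (ContinuousLinearMap.isPositive_iff _).2 ⟨fun x y => ?_, fun x => ?_⟩
  · change inner ℝ (block22 Q x) y = inner ℝ x (block22 Q y)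
    rw [real_inner_comm, hin, hin, inner_symm_of_isSymmetric hQ.isSymmetric]
  · rw [real_inner_comm, hin]
    exact hQ.inner_nonneg_right _

end Blocks

/-! ### Consequences of the bounds on the generalized Hessians -/

section Smooth

/-- Subtracting the quadratic of slope `f' 0` and curvature `c` leaves a function with nonnegative
derivative on `(0, 1)`. -/
theorem add_half_le_of_deriv {f f' : ℝ → ℝ} (hf : ∀ t, HasDerivAt f (f' t) t) {c : ℝ}
    (h : ∀ t, 0 < t → t < 1 → c * t ≤ f' t - f' 0) : f 0 + f' 0 + c / 2 ≤ f 1 := by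
  have hd : ∀ t, HasDerivAt (fun t => f t - t * f' 0 - c / 2 * t ^ 2) (f' t - f' 0 - c * t) t := by
    intro t
    have := ((hf t).sub ((hasDerivAt_id t).mul_const (f' 0))).sub
      ((hasDerivAt_pow 2 t).const_mul (c / 2))
    refine this.congr_deriv ?_
    simp
    ring
  have hmono : MonotoneOn (fun t => f t - t * f' 0 - c / 2 * t ^ 2) (Set.Icc 0 1) := by
    refine monotoneOn_of_deriv_nonneg (convex_Icc 0 1)
      (fun t _ => (hd t).continuousAt.continuousWithinAt)
      (fun t _ => (hd t).differentiableAt.differentiableWithinAt) fun t ht => ?_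
    rw [interior_Icc] at ht
    rw [(hd t).deriv]
    linarith [h t ht.1 ht.2]
  have := hmono (Set.left_mem_Icc.2 zero_le_one) (Set.right_mem_Icc.2 zero_le_one) zero_le_one
  simp only at this
  linarith

variable {E : Type*} [NormedAddCommGroup E] [InnerProductSpace ℝ E] [FiniteDimensional ℝ E]

theorem fderiv_gradient_mem_clarkeHessian {φ : E → ℝ} {z : E}
    (hz : DifferentiableAt ℝ (gradient φ) z) : fderiv ℝ (gradient φ) z ∈ clarkeHessian φ z :=
  subset_convexHull ℝ _ ⟨fun _ => z, tendsto_const_nhds, fun _ => hz, tendsto_const_nhds⟩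

theorem hasDerivAt_along_line {φ : E → ℝ} (hφ : Differentiable ℝ φ) (w d : E) (t : ℝ) :
    HasDerivAt (fun t : ℝ => φ (w + t • d)) (inner ℝ (gradient φ (w + t • d)) d) t := by
  have h1 : HasDerivAt (fun t : ℝ => w + t • d) d t := by
    simpa using ((hasDerivAt_id t).smul_const d).const_add w
  have h2 := (hφ (w + t • d)).hasGradientAt.hasFDerivAt
  exact (h2.comp_hasDerivAt t h1).congr_deriv (by simp)

theorem lower_quadratic_bound {φ : E → ℝ} (hφ : Differentiable ℝ φ) {G : E →L[ℝ] E}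
    (h : ∀ w w', normSq G (w - w') ≤ inner ℝ (gradient φ w - gradient φ w') (w - w')) (w w' : E) :
    φ w' + inner ℝ (gradient φ w') (w - w') + 1 / 2 * normSq G (w - w') ≤ φ w := by
  have := add_half_le_of_deriv (hasDerivAt_along_line hφ w' (w - w')) (c := normSq G (w - w'))
    fun t ht _ => by
      have h1 := h (w' + t • (w - w')) w'
      rw [add_sub_cancel_left, normSq_smul, inner_smul_right] at h1
      have h2 : t * (normSq G (w - w') * t) ≤
          t * inner ℝ (gradient φ (w' + t • (w - w')) - gradient φ w') (w - w') := by linarith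
      have h3 := le_of_mul_le_mul_left h2 ht
      rw [inner_sub_left] at h3
      simp only [zero_smul, add_zero]
      linarith
  simp only [zero_smul, add_zero, one_smul, add_sub_cancel] at this
  linarith

theorem upper_quadratic_bound {φ : E → ℝ} (hφ : Differentiable ℝ φ) {G : E →L[ℝ] E}
    (h : ∀ w w', inner ℝ (gradient φ w - gradient φ w') (w - w') ≤ normSq G (w - w')) (w w' : E) :
    φ w ≤ φ w' + inner ℝ (gradient φ w') (w - w') + 1 / 2 * normSq G (w - w') := by
  have := add_half_le_of_deriv (fun t => (hasDerivAt_along_line hφ w' (w - w') t).neg)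
    (c := - normSq G (w - w')) fun t ht _ => by
      have h1 := h (w' + t • (w - w')) w'
      rw [add_sub_cancel_left, normSq_smul, inner_smul_right] at h1
      have h2 : t * inner ℝ (gradient φ (w' + t • (w - w')) - gradient φ w') (w - w') ≤
          t * (normSq G (w - w') * t) := by linarith
      have h3 := le_of_mul_le_mul_left h2 ht
      rw [inner_sub_left] at h3
      simp only [zero_smul, add_zero]
      linarith
  simp only [Pi.neg_apply, zero_smul, add_zero, one_smul, add_sub_cancel] at this
  linarith

end Smooth

/-! ### The majorization of the smooth part -/

section Majorization

variable {U V X : Type*}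
  [NormedAddCommGroup U] [InnerProductSpace ℝ U] [FiniteDimensional ℝ U]
  [NormedAddCommGroup V] [InnerProductSpace ℝ V] [FiniteDimensional ℝ V]
  [NormedAddCommGroup X] [InnerProductSpace ℝ X] [FiniteDimensional ℝ X]
  {P : Problem U V X} {a : Params U V}

theorem Params.normSq_add_H (w : Prod2 U V) :
    normSq (a.Q + a.H) w = normSq a.Q w + normSq a.D₁ w.fst + normSq a.D₂ w.snd := by
  have h : normSq a.H w = normSq a.D₁ w.fst + normSq a.D₂ w.snd :=
    normSq_blockDiag a.D₁ a.D₂ w.fst w.snd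
  rw [add_assoc, ← h]
  simp [normSq, inner_add_right]

theorem Params.Admissible.isSymmetric_add_H {φ : Prod2 U V → ℝ} (ha : a.Admissible φ) :
    (a.Q + a.H).IsSymmetric := by
  have := ha.Q_psd.isSymmetric.add
    (isSymmetric_blockDiag ha.D₁_psd.isSymmetric ha.D₂_psd.isSymmetric)
  exact this

/-- Increments of the gradient are given by an operator satisfying the bounds imposed on the
generalized Hessians. -/
theorem exists_operator_gradient_sub (hP : P.Standing) (ha : a.Admissible P.φ) {η : ℝ}
    (hη : a.CrossControl P.φ η) (w w' : Prod2 U V) :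
    ∃ W : Prod2 U V →L[ℝ] Prod2 U V, (W - a.Q).IsPositive ∧ (a.Q + a.H - W).IsPositive ∧
      (∀ (u : U) (v : V), |inner ℝ u ((block12 W - block12 a.Q) v)|
        ≤ η / 2 * (normSq a.D₁ u + normSq a.D₂ v)) ∧
      gradient P.φ w - gradient P.φ w' = W (w - w') := by
  obtain ⟨C, hC⟩ := hP.φ_lipschitz
  have hpos : ∀ {G G' : Prod2 U V →L[ℝ] Prod2 U V} {r s : ℝ}, G.IsPositive → G'.IsPositive →
      0 ≤ r → 0 ≤ s → (r • G + s • G').IsPositive := fun hG hG' hr hs =>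
    (hG.smul_of_nonneg hr).add (hG'.smul_of_nonneg hs)
  have hblock : ∀ (u : U) (v : V) (W : Prod2 U V →L[ℝ] Prod2 U V),
      inner ℝ u ((block12 W - block12 a.Q) v) = inner ℝ (pair u 0) ((W - a.Q) (pair 0 v)) := by
    intro u v W
    rw [inner_pair_left, inner_zero_left, add_zero]
    rfl
  -- All three conditions are closed and convex in `W`, so they pass from the Hessians, where these
  -- exist, to averages along segments.
  let K : Set (Prod2 U V →L[ℝ] Prod2 U V) := {W | (W - a.Q).IsPositive} ∩
    ({W | (a.Q + a.H - W).IsPositive} ∩ ⋂ u : U, ⋂ v : V,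
      {W | |inner ℝ u ((block12 W - block12 a.Q) v)| ≤ η / 2 * (normSq a.D₁ u + normSq a.D₂ v)})
  have hKcl : IsClosed K := by
    refine (isClosed_setOf_isPositive.preimage (by fun_prop)).inter
      ((isClosed_setOf_isPositive.preimage (by fun_prop)).inter
        (isClosed_iInter fun u => isClosed_iInter fun v => ?_))
    simp only [hblock]
    exact isClosed_le (by fun_prop) continuous_const
  have hKc : Convex ℝ K := by
    intro W ⟨h1, h2, h3⟩ W' ⟨h1', h2', h3'⟩ r s hr hs hrs
    refine ⟨?_, ?_, Set.mem_iInter₂.2 fun u v => ?_⟩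
    · have := hpos h1 h1' hr hs
      rwa [show r • (W - a.Q) + s • (W' - a.Q) = r • W + s • W' - (r + s) • a.Q by module, hrs,
        one_smul] at this
    · have := hpos h2 h2' hr hs
      rwa [show r • (a.Q + a.H - W) + s • (a.Q + a.H - W') =
        (r + s) • (a.Q + a.H) - (r • W + s • W') by module, hrs, one_smul] at this
    · have h4 := Set.mem_iInter₂.1 h3 u v
      have h4' := Set.mem_iInter₂.1 h3' u v
      simp only [Set.mem_ofPred_eq, hblock] at h4 h4' ⊢
      have h5 : inner ℝ (pair u (0 : V)) ((r • W + s • W' - a.Q) (pair 0 v)) =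
          r * inner ℝ (pair u (0 : V)) ((W - a.Q) (pair 0 v))
            + s * inner ℝ (pair u (0 : V)) ((W' - a.Q) (pair 0 v)) := by
        rw [show r • W + s • W' - a.Q = r • W + s • W' - (r + s) • a.Q by rw [hrs, one_smul],
          show r • W + s • W' - (r + s) • a.Q = r • (W - a.Q) + s • (W' - a.Q) by module]
        simp only [add_apply, smul_apply, inner_add_right, inner_smul_right]
      rw [h5]
      calc _ ≤ r * |inner ℝ (pair u (0 : V)) ((W - a.Q) (pair 0 v))|
            + s * |inner ℝ (pair u (0 : V)) ((W' - a.Q) (pair 0 v))| := by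
              refine (abs_add_le _ _).trans_eq ?_
              rw [abs_mul, abs_mul, abs_of_nonneg hr, abs_of_nonneg hs]
        _ ≤ r * (η / 2 * (normSq a.D₁ u + normSq a.D₂ v))
            + s * (η / 2 * (normSq a.D₁ u + normSq a.D₂ v)) := by gcongr
        _ = _ := by rw [← add_mul, hrs, one_mul]
  obtain ⟨W, hW, h⟩ := exists_mem_sub_eq_of_lipschitz hC hKc hKcl (fun z hz => by
    have hmem := fderiv_gradient_mem_clarkeHessian hz
    exact ⟨(ha.hessian_bounds z _ hmem).1, (ha.hessian_bounds z _ hmem).2,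
      Set.mem_iInter₂.2 fun u v => hη.2 z _ hmem u v⟩) w w'
  exact ⟨W, hW.1, hW.2.1, fun u v => Set.mem_iInter₂.1 hW.2.2 u v, h⟩

theorem smooth_lower_bound (hP : P.Standing) (ha : a.Admissible P.φ) {η : ℝ}
    (hη : a.CrossControl P.φ η) (w w' : Prod2 U V) :
    P.φ w' + inner ℝ (gradient P.φ w') (w - w') + 1 / 2 * normSq a.Q (w - w') ≤ P.φ w := by
  refine lower_quadratic_bound hP.φ_differentiable (fun w w' => ?_) w w'
  obtain ⟨W, hW, -, -, h⟩ := exists_operator_gradient_sub hP ha hη w w'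
  rw [h, real_inner_comm]
  exact normSq_le_of_isPositive_sub hW _

theorem smooth_upper_bound (hP : P.Standing) (ha : a.Admissible P.φ) {η : ℝ}
    (hη : a.CrossControl P.φ η) (w w' : Prod2 U V) :
    P.φ w ≤ P.φ w' + inner ℝ (gradient P.φ w') (w - w') + 1 / 2 * normSq (a.Q + a.H) (w - w') := by
  refine upper_quadratic_bound hP.φ_differentiable (fun w w' => ?_) w w'
  obtain ⟨W, -, hW, -, h⟩ := exists_operator_gradient_sub hP ha hη w w'
  rw [h, real_inner_comm]
  exact normSq_le_of_isPositive_sub hW _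

/-- Three-point inequality: the gradient is taken at the old iterate `w`, the test direction starts
from the new one `w'`. An upper bound from `w` to `w'` and lower bounds from `w` to `z` and from `z`
to `w'` are added, so that the values of `φ` cancel; only the increment `w' - w` is charged with
`H`. -/
theorem inner_gradient_sub_ge (hP : P.Standing) (ha : a.Admissible P.φ) {η : ℝ}
    (hη : a.CrossControl P.φ η) (w w' z : Prod2 U V) :
    1 / 2 * normSq a.Q (w - z) + 1 / 2 * normSq a.Q (w' - z) - 1 / 2 * normSq (a.Q + a.H) (w' - w)
      ≤ inner ℝ (gradient P.φ w - gradient P.φ z) (w' - z) := by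
  have h1 := smooth_lower_bound hP ha hη z w
  have h2 := smooth_upper_bound hP ha hη w' w
  have h3 := smooth_lower_bound hP ha hη w' z
  rw [← normSq_neg, neg_sub] at h1
  have h4 : inner ℝ (gradient P.φ w) (w' - z)
      = inner ℝ (gradient P.φ w) (w' - w) - inner ℝ (gradient P.φ w) (z - w) := by
    rw [← inner_sub_right]
    congr 1
    abel
  rw [inner_sub_left, h4]
  linarith

end Majorization

/-! ### Karush-Kuhn-Tucker points -/

section KKT

variable {U V X : Type*}
  [NormedAddCommGroup U] [InnerProductSpace ℝ U] [FiniteDimensional ℝ U]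
  [NormedAddCommGroup V] [InnerProductSpace ℝ V] [FiniteDimensional ℝ V]
  [NormedAddCommGroup X] [InnerProductSpace ℝ X] [FiniteDimensional ℝ X]
  {P : Problem U V X} {a : Params U V}

/-- The two subgradient inequalities and the lower quadratic bound with `Q ⪰ 0` add up; the
multiplier terms cancel because both points are feasible. -/
theorem Problem.isSolution_of_isKKT (hP : P.Standing) (ha : a.Admissible P.φ) {η : ℝ}
    (hη : a.CrossControl P.φ η) {u : U} {v : V} {x : X} (h : P.IsKKT u v x) :
    P.IsSolution u v := by
  obtain ⟨⟨ξ, hξ, hξ'⟩, ⟨ζ, hζ, hζ'⟩, hc⟩ := h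
  refine ⟨hc, fun u' v' hc' => ?_⟩
  have hu := hP.p_convex.mem_dom_of_mem_subdifferential hξ
  have hv := hP.q_convex.mem_dom_of_mem_subdifferential hζ
  unfold Problem.objective
  by_cases hu' : u' ∈ dom P.p
  swap
  · rw [show P.p u' = ⊤ from not_lt_top_iff.1 hu',
      EReal.top_add_of_ne_bot (hP.q_convex.ne_bot _), EReal.top_add_coe]
    exact le_top
  by_cases hv' : v' ∈ dom P.q
  swap
  · rw [show P.q v' = ⊤ from not_lt_top_iff.1 hv',
      EReal.add_top_of_ne_bot (hP.p_convex.ne_bot _), EReal.top_add_coe]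
    exact le_top
  rw [← hP.p_convex.coe_toReal hu, ← hP.p_convex.coe_toReal hu', ← hP.q_convex.coe_toReal hv,
    ← hP.q_convex.coe_toReal hv']
  have h1 := (hP.p_convex.mem_subdifferential_iff hu).1 hξ u' hu'
  have h2 := (hP.q_convex.mem_subdifferential_iff hv).1 hζ v' hv'
  have h3 := smooth_lower_bound hP ha hη (pair u' v') (pair u v)
  have h4 := normSq_nonneg ha.Q_psd (pair u' v' - pair u v)
  rw [← pair_sub, inner_pair_right] at h3
  rw [eq_neg_of_add_eq_zero_left hξ' |> fun h => (eq_sub_of_add_eq h)] at h3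
  rw [eq_neg_of_add_eq_zero_left hζ' |> fun h => (eq_sub_of_add_eq h)] at h3
  have h5 : inner ℝ (P.A x) (u' - u) + inner ℝ (P.B x) (v' - v) = 0 := by
    rw [← ContinuousLinearMap.adjoint_inner_right, ← ContinuousLinearMap.adjoint_inner_right,
      ← inner_add_right]
    have : P.Aadj (u' - u) + P.Badj (v' - v) = 0 := by
      rw [map_sub, map_sub, sub_add_sub_comm, hc, hc', sub_self]
    change inner ℝ x (P.Aadj (u' - u) + P.Badj (v' - v)) = 0
    rw [this, inner_zero_right]
  simp only [inner_sub_left, inner_neg_left] at h3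
  rw [← pair_sub] at h4
  norm_cast
  linarith

/-- Under the constraint qualification every solution has a multiplier. -/
theorem Problem.exists_isKKT (hP : P.Standing) (ha : a.Admissible P.φ) {η : ℝ}
    (hη : a.CrossControl P.φ η) (hCQ : P.ConstraintQualification) {u : U} {v : V}
    (h : P.IsSolution u v) : ∃ x, P.IsKKT u v x := by
  obtain ⟨u₀, v₀, hri, hc₀⟩ := hCQ
  obtain ⟨hc, hmin⟩ := h
  have hK₀ := intrinsicInterior_subset hri
  have hfin : ∀ u' ∈ dom P.p, ∀ v' ∈ dom P.q, P.objective u' v' =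
      (((P.p u').toReal + (P.q v').toReal + P.φ (pair u' v') : ℝ) : EReal) := by
    intro u' hu' v' hv'
    rw [Problem.objective, ← hP.p_convex.coe_toReal hu', ← hP.q_convex.coe_toReal hv']
    norm_cast
  have hlt : P.objective u v < ⊤ := by
    refine (hmin u₀ v₀ hc₀).trans_lt ?_
    rw [hfin _ hK₀.1 _ hK₀.2]
    exact EReal.coe_lt_top _
  have hu : u ∈ dom P.p := by
    by_contra hu
    rw [Problem.objective, show P.p u = ⊤ from not_lt_top_iff.1 hu,
      EReal.top_add_of_ne_bot (hP.q_convex.ne_bot _), EReal.top_add_coe] at hlt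
    exact lt_irrefl _ hlt
  have hv : v ∈ dom P.q := by
    by_contra hv
    rw [Problem.objective, show P.q v = ⊤ from not_lt_top_iff.1 hv,
      EReal.add_top_of_ne_bot (hP.p_convex.ne_bot _), EReal.top_add_coe] at hlt
    exact lt_irrefl _ hlt
  let e : (U × V) →L[ℝ] Prod2 U V := (WithLp.prodContinuousLinearEquiv 2 ℝ U V).symm
  set g : Prod2 U V := gradient P.φ (pair u v) with hg
  set K : Set (U × V) := dom P.p ×ˢ dom P.q with hK
  have hF : ConvexOn ℝ K fun w : U × V => (P.p w.1).toReal + (P.q w.2).toReal :=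
    ((hP.p_convex.convexOn_toReal.comp_linearMap (LinearMap.fst ℝ U V)).subset
        (fun w hw => hw.1) (hP.p_convex.convexOn_toReal.1.prod hP.q_convex.convexOn_toReal.1)).add
      ((hP.q_convex.convexOn_toReal.comp_linearMap (LinearMap.snd ℝ U V)).subset
        (fun w hw => hw.2) (hP.p_convex.convexOn_toReal.1.prod hP.q_convex.convexOn_toReal.1))
  let L : (U × V) →ₗ[ℝ] X :=
    P.Aadj.toLinearMap ∘ₗ LinearMap.fst ℝ U V + P.Badj.toLinearMap ∘ₗ LinearMap.snd ℝ U V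
  have hL : ∀ w : U × V, L w = P.Aadj w.1 + P.Badj w.2 := fun _ => rfl
  let lin : (U × V) →ₗ[ℝ] ℝ := (innerₗ (Prod2 U V) g) ∘ₗ e.toLinearMap
  have hlin : ∀ w : U × V, lin w = inner ℝ g.fst w.1 + inner ℝ g.snd w.2 := fun _ => rfl
  have hFl : ConvexOn ℝ K fun w : U × V => (P.p w.1).toReal + (P.q w.2).toReal + lin w :=
    hF.add (lin.convexOn hF.1)
  -- The multiplier is taken for the objective linearized at `(u, v)`. The resulting inequality
  -- splits into a `u`-part and a `v`-part, so freezing either variable yields one subgradient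
  -- condition.
  obtain ⟨x, hx⟩ := exists_multiplier hFl L (c := P.c)
    (m := (P.p u).toReal + (P.q v).toReal + lin (u, v)) hK₀ hc₀
    (fun w hw => exists_prolongation_of_mem_intrinsicInterior hri hw) (by
      rintro ⟨u', v'⟩ hw hLw
      have hconv : ∀ t : ℝ, 0 < t → t ≤ 1 → (u, v) + t • ((u', v') - (u, v)) ∈ K := by
        intro t ht ht1
        have := hF.1 (x := (u, v)) ⟨hu, hv⟩ hw (sub_nonneg.2 ht1) ht.le (sub_add_cancel 1 t)
        rwa [show (1 - t) • (u, v) + t • (u', v') = (u, v) + t • ((u', v') - (u, v)) by module]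
          at this
      have hFE : ConvexOn ℝ (WithLp.ofLp ⁻¹' K : Set (Prod2 U V))
          fun w => (P.p w.fst).toReal + (P.q w.snd).toReal :=
        hF.comp_linearMap (WithLp.linearEquiv 2 ℝ (U × V)).toLinearMap
      have hle : (P.p u).toReal + (P.q v).toReal ≤ (P.p u').toReal + (P.q v').toReal
          + inner ℝ g (pair u' v' - pair u v) := linearized_minimizer hFE (h := P.φ) (x := pair u v) (g := g) (y := pair u' v')
        ⟨hu, hv⟩ (fun d => ⟨1 / 2 * normSq (a.Q + a.H) d, fun t ht _ => by
          have := smooth_upper_bound hP ha hη (pair u v + t • d) (pair u v)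
          rw [add_sub_cancel_left, inner_smul_right, normSq_smul] at this
          linarith⟩) hw (fun t ht ht1 => by
          have hmem : (u + t • (u' - u), v + t • (v' - v)) ∈ K := hconv t ht ht1
          have hfeas : P.Aadj (u + t • (u' - u)) + P.Badj (v + t • (v' - v)) = P.c := by
            have hLw' : P.Aadj u' + P.Badj v' = P.c := hLw
            have h6 : P.Aadj (u + t • (u' - u)) + P.Badj (v + t • (v' - v)) =
                (P.Aadj u + P.Badj v)
                  + t • ((P.Aadj u' + P.Badj v') - (P.Aadj u + P.Badj v)) := by
              simp only [map_add, map_smul, map_sub]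
              module
            rw [h6, hLw', hc, sub_self, smul_zero, add_zero]
          have h5 := hmin _ _ hfeas
          rw [hfin _ hu _ hv, hfin _ hmem.1 _ hmem.2, EReal.coe_le_coe_iff] at h5
          exact h5)
      rw [← pair_sub, inner_pair_right] at hle
      simp only [inner_sub_right] at hle
      simp only [hlin]
      linarith)
  simp only [hL, hlin] at hx
  have hxA : ∀ u' v', inner ℝ x (P.Aadj u' + P.Badj v' - P.c) =
      inner ℝ (P.A x) (u' - u) + inner ℝ (P.B x) (v' - v) := by
    intro u' v'
    rw [← ContinuousLinearMap.adjoint_inner_right, ← ContinuousLinearMap.adjoint_inner_right,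
      ← inner_add_right, ← hc]
    congr 1
    change _ = P.Aadj (u' - u) + P.Badj (v' - v)
    rw [map_sub, map_sub]
    abel
  refine ⟨x, ⟨-(g.fst + P.A x), ?_, by rw [← hg]; abel⟩, ⟨-(g.snd + P.B x), ?_,
    by rw [← hg]; abel⟩, hc⟩
  · refine (hP.p_convex.mem_subdifferential_iff hu).2 fun u' hu' => ?_
    have := hx (u', v) ⟨hu', hv⟩
    rw [hxA, sub_self, inner_zero_right, add_zero] at this
    simp only [inner_neg_left, inner_add_left, inner_sub_right] at this ⊢
    linarith
  · refine (hP.q_convex.mem_subdifferential_iff hv).2 fun v' hv' => ?_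
    have := hx (u, v') ⟨hu, hv'⟩
    rw [hxA, sub_self, inner_zero_right, zero_add] at this
    simp only [inner_neg_left, inner_add_left, inner_sub_right] at this ⊢
    linarith

end KKT

/-! ### Optimality conditions of the subproblems -/

section Subproblems

variable {U V X : Type*}
  [NormedAddCommGroup U] [InnerProductSpace ℝ U] [FiniteDimensional ℝ U]
  [NormedAddCommGroup V] [InnerProductSpace ℝ V] [FiniteDimensional ℝ V]
  [NormedAddCommGroup X] [InnerProductSpace ℝ X] [FiniteDimensional ℝ X]
  {P : Problem U V X} {a : Params U V}

theorem Problem.inner_A (P : Problem U V X) (x : X) (u : U) :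
    inner ℝ (P.A x) u = inner ℝ x (P.Aadj u) :=
  (ContinuousLinearMap.adjoint_inner_right P.A x u).symm

theorem Problem.inner_B (P : Problem U V X) (x : X) (v : V) :
    inner ℝ (P.B x) v = inner ℝ x (P.Badj v) :=
  (ContinuousLinearMap.adjoint_inner_right P.B x v).symm

theorem Params.majorant_add_smul {φ : Prod2 U V → ℝ} (ha : a.Admissible φ) (w w' δ : Prod2 U V)
    (t : ℝ) : a.majorant φ (w + t • δ) w' = a.majorant φ w w'
      + t * inner ℝ (gradient φ w' + (a.Q + a.H) (w - w')) δ
      + t ^ 2 * (1 / 2 * normSq (a.Q + a.H) δ) := by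
  have h1 : w' - (w + t • δ) = -((w - w') + t • δ) := by abel
  have h2 : w' - w = -(w - w') := by abel
  have h3 : w + t • δ - w' = (w - w') + t • δ := by abel
  rw [Params.majorant, Params.majorant, h1, h2, h3, normSq_neg, normSq_neg,
    normSq_add ha.isSymmetric_add_H, normSq_smul, inner_add_right, inner_smul_right, map_smul,
    inner_smul_right, inner_add_left, inner_symm_of_isSymmetric ha.isSymmetric_add_H,
    real_inner_comm δ ((a.Q + a.H) (w - w'))]
  ring

theorem inner_add_norm_sq_add_smul (x r y : X) (σ t : ℝ) :
    inner ℝ x (r + t • y) + σ / 2 * ‖r + t • y‖ ^ 2 = inner ℝ x r + σ / 2 * ‖r‖ ^ 2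
      + t * inner ℝ (x + σ • r) y + t ^ 2 * (σ / 2 * ‖y‖ ^ 2) := by
  rw [norm_add_sq_real, inner_add_right, inner_smul_right, inner_smul_right, norm_smul,
    inner_add_left, inner_smul_left, mul_pow, Real.norm_eq_abs, sq_abs]
  simp
  ring

theorem normSq_add_smul {E : Type*} [NormedAddCommGroup E] [InnerProductSpace ℝ E]
    {G : E →L[ℝ] E} (hG : G.IsSymmetric) (y d : E) (t : ℝ) :
    normSq G (y + t • d) = normSq G y + 2 * t * inner ℝ (G y) d + t ^ 2 * normSq G d := by
  rw [normSq_add hG, normSq_smul, map_smul, inner_smul_right, inner_symm_of_isSymmetric hG,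
    real_inner_comm]
  ring

/-- Finiteness of `P.q v` is essential: otherwise the subproblem is identically `⊤` and minimality
says nothing. When finite, it is a constant absorbed into the smooth part. -/
theorem subgradient_of_isMinOn_left (hP : P.Standing) (ha : a.Admissible P.φ) {u₀ u₁ : U}
    {v : V} {x : X} {w : Prod2 U V} (hv : v ∈ dom P.q)
    (hmin : IsMinOn (fun u' => a.lagrangian P u' v x w
      + ((1 / 2 * normSq a.S (u' - u₀) : ℝ) : EReal)) Set.univ u₁) :
    -((gradient P.φ w + (a.Q + a.H) (pair u₁ v - w)).fst + P.A (x + a.σ • P.residual u₁ v)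
      + a.S (u₁ - u₀)) ∈ subdifferential P.p u₁ := by
  let h : U → ℝ := fun y => (P.q v).toReal + (a.majorant P.φ (pair y v) w
    + (inner ℝ x (P.residual y v) + a.σ / 2 * ‖P.residual y v‖ ^ 2))
    + 1 / 2 * normSq a.S (y - u₀)
  refine hP.p_convex.neg_mem_subdifferential_of_isMinOn (h := h) (fun y => ?_) fun d =>
    ⟨1 / 2 * normSq (a.Q + a.H) (pair d 0) + a.σ / 2 * ‖P.Aadj d‖ ^ 2 + 1 / 2 * normSq a.S d,
      fun t _ _ => le_of_eq ?_⟩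
  · have h1 : ∀ y, a.lagrangian P y v x w + ((1 / 2 * normSq a.S (y - u₀) : ℝ) : EReal)
        = P.p y + (h y : EReal) := by
      intro y
      simp only [Params.lagrangian, h]
      rw [← hP.q_convex.coe_toReal hv, EReal.toReal_coe, add_assoc (P.p y), add_assoc (P.p y),
        ← EReal.coe_add, ← EReal.coe_add, add_assoc (a.majorant _ _ _)]
    have h2 := isMinOn_iff.1 hmin y (Set.mem_univ y)
    simp only [h1] at h2
    exact h2
  · have h1 : pair (u₁ + t • d) v = pair u₁ v + t • pair d (0 : V) := by
      change _ = pair (u₁ + t • d) (v + t • 0)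
      rw [smul_zero, add_zero]
    have h2 : P.residual (u₁ + t • d) v = P.residual u₁ v + t • P.Aadj d := by
      simp only [Problem.residual, map_add, map_smul]
      abel
    have h3 : u₁ + t • d - u₀ = (u₁ - u₀) + t • d := by abel
    simp only [h]
    rw [h1, h2, h3, a.majorant_add_smul ha, inner_add_norm_sq_add_smul,
      normSq_add_smul ha.S_psd.isSymmetric, inner_pair_right, inner_zero_right, add_zero]
    simp only [inner_add_left, P.inner_A]
    ring

theorem subgradient_of_isMinOn_right (hP : P.Standing) (ha : a.Admissible P.φ) {u : U}
    {v₀ v₁ : V} {x : X} {w : Prod2 U V} (hu : u ∈ dom P.p)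
    (hmin : IsMinOn (fun v' => a.lagrangian P u v' x w
      + ((1 / 2 * normSq a.T (v' - v₀) : ℝ) : EReal)) Set.univ v₁) :
    -((gradient P.φ w + (a.Q + a.H) (pair u v₁ - w)).snd + P.B (x + a.σ • P.residual u v₁)
      + a.T (v₁ - v₀)) ∈ subdifferential P.q v₁ := by
  let h : V → ℝ := fun y => (P.p u).toReal + (a.majorant P.φ (pair u y) w
    + (inner ℝ x (P.residual u y) + a.σ / 2 * ‖P.residual u y‖ ^ 2))
    + 1 / 2 * normSq a.T (y - v₀)
  refine hP.q_convex.neg_mem_subdifferential_of_isMinOn (h := h) (fun y => ?_) fun d =>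
    ⟨1 / 2 * normSq (a.Q + a.H) (pair 0 d) + a.σ / 2 * ‖P.Badj d‖ ^ 2 + 1 / 2 * normSq a.T d,
      fun t _ _ => le_of_eq ?_⟩
  · have h1 : ∀ y, a.lagrangian P u y x w + ((1 / 2 * normSq a.T (y - v₀) : ℝ) : EReal)
        = P.q y + (h y : EReal) := by
      intro y
      simp only [Params.lagrangian, h]
      rw [← hP.p_convex.coe_toReal hu, EReal.toReal_coe, add_comm ((P.p u).toReal : EReal),
        add_assoc (P.q y), add_assoc (P.q y),
        ← EReal.coe_add, ← EReal.coe_add, add_assoc (a.majorant _ _ _)]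
    have h2 := isMinOn_iff.1 hmin y (Set.mem_univ y)
    simp only [h1] at h2
    exact h2
  · have h1 : pair u (v₁ + t • d) = pair u v₁ + t • pair (0 : U) d := by
      change _ = pair (u + t • 0) (v₁ + t • d)
      rw [smul_zero, add_zero]
    have h2 : P.residual u (v₁ + t • d) = P.residual u v₁ + t • P.Badj d := by
      simp only [Problem.residual, map_add, map_smul]
      abel
    have h3 : v₁ + t • d - v₀ = (v₁ - v₀) + t • d := by abel
    simp only [h]
    rw [h1, h2, h3, a.majorant_add_smul ha, inner_add_norm_sq_add_smul,
      normSq_add_smul ha.T_psd.isSymmetric, inner_pair_right, inner_zero_right, zero_add]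
    simp only [inner_add_left, P.inner_B]
    ring

/-- The subgradient of `p` selected by the `u`-step from `(u₀, v₀, x₀)` to `u₁`. -/
def Params.uSubgradient (a : Params U V) (P : Problem U V X) (u₀ u₁ : U) (v₀ : V) (x₀ : X) : U :=
  -((gradient P.φ (pair u₀ v₀)).fst + block11 a.Q (u₁ - u₀) + a.D₁ (u₁ - u₀)
    + P.A (x₀ + a.σ • P.residual u₁ v₀) + a.S (u₁ - u₀))

/-- The subgradient of `q` selected by the `v`-step from `(u₀, v₀, x₀)` to `(u₁, v₁)`. -/
def Params.vSubgradient (a : Params U V) (P : Problem U V X) (u₀ u₁ : U) (v₀ v₁ : V) (x₀ : X) : V :=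
  -((gradient P.φ (pair u₀ v₀)).snd + (a.Q (pair (u₁ - u₀) (v₁ - v₀))).snd + a.D₂ (v₁ - v₀)
    + P.B (x₀ + a.σ • P.residual u₁ v₁) + a.T (v₁ - v₀))

namespace Params.IsGenerated

variable {u : ℕ → U} {v : ℕ → V} {x : ℕ → X}

theorem uSubgradient_mem_of_mem_dom (hgen : a.IsGenerated P u v x) (hP : P.Standing)
    (ha : a.Admissible P.φ) {k : ℕ} (hv : v k ∈ dom P.q) :
    a.uSubgradient P (u k) (u (k + 1)) (v k) (x k) ∈ subdifferential P.p (u (k + 1)) := by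
  have h := subgradient_of_isMinOn_left hP ha hv (hgen.step_u k)
  convert h using 2
  have h1 : (a.H (pair (u (k + 1) - u k) (0 : V))).fst = a.D₁ (u (k + 1) - u k) := by
    rw [Params.H, blockDiag_apply]
    rfl
  rw [← pair_sub, sub_self, Params.uSubgradient, neg_inj]
  change _ = (gradient P.φ (pair (u k) (v k))).fst + ((a.Q (pair (u (k + 1) - u k) (0 : V))).fst
    + (a.H (pair (u (k + 1) - u k) (0 : V))).fst) + _ + _
  rw [h1, fst_apply_pair, map_zero, add_zero, add_assoc (gradient P.φ _).fst]

theorem vSubgradient_mem_of_mem_dom (hgen : a.IsGenerated P u v x) (hP : P.Standing)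
    (ha : a.Admissible P.φ) {k : ℕ} (hu : u (k + 1) ∈ dom P.p) :
    a.vSubgradient P (u k) (u (k + 1)) (v k) (v (k + 1)) (x k)
      ∈ subdifferential P.q (v (k + 1)) := by
  have h := subgradient_of_isMinOn_right hP ha hu (hgen.step_v k)
  convert h using 2
  have h1 : (a.H (pair (u (k + 1) - u k) (v (k + 1) - v k))).snd = a.D₂ (v (k + 1) - v k) := by
    rw [Params.H, blockDiag_apply]
    rfl
  rw [← pair_sub, Params.vSubgradient, neg_inj]
  change _ = (gradient P.φ (pair (u k) (v k))).snd
    + ((a.Q (pair (u (k + 1) - u k) (v (k + 1) - v k))).snd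
    + (a.H (pair (u (k + 1) - u k) (v (k + 1) - v k))).snd) + _ + _
  rw [h1, add_assoc (gradient P.φ _).snd]

/-- The induction alternates between blocks: the `u`-step is informative once `v k` is in the
domain, the `v`-step once `u (k + 1)` is. -/
theorem mem_dom (hgen : a.IsGenerated P u v x) (hP : P.Standing) (ha : a.Admissible P.φ) (k : ℕ) :
    u k ∈ dom P.p ∧ v k ∈ dom P.q := by
  induction k with
  | zero => exact ⟨hgen.init_u, hgen.init_v⟩
  | succ k ih =>
    have hu := hP.p_convex.mem_dom_of_mem_subdifferential
      (hgen.uSubgradient_mem_of_mem_dom hP ha ih.2)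
    exact ⟨hu, hP.q_convex.mem_dom_of_mem_subdifferential
      (hgen.vSubgradient_mem_of_mem_dom hP ha hu)⟩

theorem uSubgradient_mem (hgen : a.IsGenerated P u v x) (hP : P.Standing)
    (ha : a.Admissible P.φ) (k : ℕ) :
    a.uSubgradient P (u k) (u (k + 1)) (v k) (x k) ∈ subdifferential P.p (u (k + 1)) :=
  hgen.uSubgradient_mem_of_mem_dom hP ha (hgen.mem_dom hP ha k).2

theorem vSubgradient_mem (hgen : a.IsGenerated P u v x) (hP : P.Standing)
    (ha : a.Admissible P.φ) (k : ℕ) :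
    a.vSubgradient P (u k) (u (k + 1)) (v k) (v (k + 1)) (x k)
      ∈ subdifferential P.q (v (k + 1)) :=
  hgen.vSubgradient_mem_of_mem_dom hP ha (hgen.mem_dom hP ha (k + 1)).1

end Params.IsGenerated

end Subproblems

/-! ### Descent of the energy -/

section Energy

variable {U V X : Type*}
  [NormedAddCommGroup U] [InnerProductSpace ℝ U] [FiniteDimensional ℝ U]
  [NormedAddCommGroup V] [InnerProductSpace ℝ V] [FiniteDimensional ℝ V]
  [NormedAddCommGroup X] [InnerProductSpace ℝ X] [FiniteDimensional ℝ X]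
  {P : Problem U V X} {a : Params U V}

theorem Params.inner_uSubgradient (u₀ u₁ : U) (v₀ : V) (x₀ : X) (y : U) :
    inner ℝ (a.uSubgradient P u₀ u₁ v₀ x₀) y =
      -(inner ℝ (gradient P.φ (pair u₀ v₀)).fst y + inner ℝ y (block11 a.Q (u₁ - u₀))
        + inner ℝ y (a.D₁ (u₁ - u₀)) + (inner ℝ x₀ (P.Aadj y)
        + a.σ * inner ℝ (P.residual u₁ v₀) (P.Aadj y)) + inner ℝ y (a.S (u₁ - u₀))) := by
  rw [uSubgradient, inner_neg_left]
  simp only [inner_add_left, P.inner_A, real_inner_smul_left]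
  rw [real_inner_comm y (block11 a.Q _), real_inner_comm y (a.D₁ _), real_inner_comm y (a.S _)]

theorem Params.inner_vSubgradient (hQ : a.Q.IsSymmetric) (u₀ u₁ : U) (v₀ v₁ : V) (x₀ : X) (y : V) :
    inner ℝ (a.vSubgradient P u₀ u₁ v₀ v₁ x₀) y =
      -(inner ℝ (gradient P.φ (pair u₀ v₀)).snd y + (inner ℝ (u₁ - u₀) (block12 a.Q y)
        + inner ℝ y (block22 a.Q (v₁ - v₀))) + inner ℝ y (a.D₂ (v₁ - v₀))
        + (inner ℝ x₀ (P.Badj y) + a.σ * inner ℝ (P.residual u₁ v₁) (P.Badj y))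
        + inner ℝ y (a.T (v₁ - v₀))) := by
  have h : inner ℝ (a.Q (pair (u₁ - u₀) (v₁ - v₀))).snd y
      = inner ℝ (u₁ - u₀) (block12 a.Q y) + inner ℝ y (block22 a.Q (v₁ - v₀)) := by
    have h1 := inner_apply_pair hQ (0 : U) (u₁ - u₀) y (v₁ - v₀)
    rw [inner_pair_left, inner_zero_left, inner_zero_left, inner_zero_left, zero_add, zero_add,
      zero_add] at h1
    rw [real_inner_comm, h1]
  rw [vSubgradient, inner_neg_left]
  simp only [inner_add_left, P.inner_B, real_inner_smul_left]
  rw [h, real_inner_comm y (a.D₂ _), real_inner_comm y (a.T _)]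

/-- The weighted squared distance of `(u, v, x)` to a reference point `(u', v', x')`. -/
def Params.energy (a : Params U V) (P : Problem U V X) (u' : U) (v' : V) (x' : X) (u : U) (v : V)
    (x : X) : ℝ :=
  1 / 2 * ((a.τ * a.σ)⁻¹ * ‖x - x'‖ ^ 2 + a.σ * ‖P.Badj (v - v')‖ ^ 2 + normSq a.D₁ (u - u')
    + normSq a.S (u - u') + normSq a.D₂ (v - v') + normSq a.T (v - v'))

theorem Params.energy_nonneg (ha : a.Admissible P.φ) (u' : U) (v' : V) (x' : X) (u : U) (v : V)
    (x : X) : 0 ≤ a.energy P u' v' x' u v x := by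
  have h1 := normSq_nonneg ha.D₁_psd (u - u')
  have h2 := normSq_nonneg ha.S_psd (u - u')
  have h3 := normSq_nonneg ha.D₂_psd (v - v')
  have h4 := normSq_nonneg ha.T_psd (v - v')
  have h5 := ha.σ_pos
  have h6 := ha.τ_pos
  unfold energy
  positivity

theorem Problem.residual_eq {u' : U} {v' : V} (hc : P.Aadj u' + P.Badj v' = P.c) (u : U) (v : V) :
    P.residual u v = P.Aadj (u - u') + P.Badj (v - v') := by
  rw [Problem.residual, ← hc, map_sub, map_sub]
  abel

theorem Problem.residual_sub_right (P : Problem U V X) (u : U) (v v' : V) :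
    P.residual u v' = P.residual u v - P.Badj (v - v') := by
  simp only [Problem.residual, map_sub]
  abel

theorem Params.normSq_add_H_pair (s : U) (t : V) :
    normSq (a.Q + a.H) (pair s t) = normSq a.Q (pair s t) + normSq a.D₁ s + normSq a.D₂ t :=
  Params.normSq_add_H (pair s t)

/-- One iteration decreases the energy with respect to a Karush-Kuhn-Tucker point. -/
theorem energy_descent (hP : P.Standing) (ha : a.Admissible P.φ) {η : ℝ}
    (hη : a.CrossControl P.φ η) {u' : U} {v' : V} {x' : X} (hK : P.IsKKT u' v' x')
    {u₀ u₁ : U} {v₀ v₁ : V} {x₀ x₁ : X}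
    (hu : a.uSubgradient P u₀ u₁ v₀ x₀ ∈ subdifferential P.p u₁)
    (hv : a.vSubgradient P u₀ u₁ v₀ v₁ x₀ ∈ subdifferential P.q v₁)
    (hx : x₁ = x₀ + (a.τ * a.σ) • P.residual u₁ v₁) :
    normSq a.Q (pair (u₁ - u') (v₁ - v')) - inner ℝ (u₁ - u') (block12 a.Q (v₁ - v₀))
      + 1 / 2 * normSq a.S (u₁ - u₀) + 1 / 2 * normSq a.T (v₁ - v₀)
      + a.σ / 2 * ((2 - a.τ) * ‖P.residual u₁ v₁‖ ^ 2
        - 2 * inner ℝ (P.residual u₁ v₁) (P.Badj (v₁ - v₀)) + ‖P.Badj (v₁ - v₀)‖ ^ 2)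
      ≤ a.energy P u' v' x' u₀ v₀ x₀ - a.energy P u' v' x' u₁ v₁ x₁ := by
  obtain ⟨⟨ξ, hξ, hξ'⟩, ⟨ζ, hζ, hζ'⟩, hc⟩ := hK
  have hξ'' : ξ = -((gradient P.φ (pair u' v')).fst + P.A x') := by
    rw [eq_neg_iff_add_eq_zero, ← hξ']; abel
  have hζ'' : ζ = -((gradient P.φ (pair u' v')).snd + P.B x') := by
    rw [eq_neg_iff_add_eq_zero, ← hζ']; abel
  have h1 := hP.p_convex.inner_subgradient_nonneg hu hξ
  have h2 := hP.q_convex.inner_subgradient_nonneg hv hζ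
  -- The `H`-part of the loss cancels the squares of the increments in `D₁` and `D₂` that arise from
  -- polarizing the energy.
  have h3 := inner_gradient_sub_ge hP ha hη (pair u₀ v₀) (pair u₁ v₁) (pair u' v')
  rw [inner_sub_left, Params.inner_uSubgradient, hξ'', inner_neg_left, inner_add_left,
    P.inner_A] at h1
  rw [inner_sub_left, Params.inner_vSubgradient ha.Q_psd.isSymmetric, hζ'', inner_neg_left,
    inner_add_left, P.inner_B] at h2
  -- The `u`-step involves the residual at `(u₁, v₀)`; expressing it at `(u₁, v₁)` is what creates
  -- the products with `P.Badj (v₁ - v₀)`.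
  rw [P.residual_sub_right u₁ v₁ v₀] at h1
  have hr := P.residual_eq hc u₁ v₁
  set r := P.residual u₁ v₁
  have hu₀ : u₀ - u' = (u₁ - u') - (u₁ - u₀) := by abel
  have hv₀ : v₀ - v' = (v₁ - v') - (v₁ - v₀) := by abel
  have hx₁ : x₁ - x' = (x₀ - x') + (a.τ * a.σ) • r := by rw [hx]; abel
  rw [← pair_sub, ← pair_sub, ← pair_sub, Params.normSq_add_H_pair, inner_sub_left, inner_pair_right,
    inner_pair_right, hu₀, hv₀] at h3
  rw [Params.energy, Params.energy, hx₁, hu₀, hv₀]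
  clear_value r
  clear hu₀ hv₀ hx₁ hu hv hx hξ hζ hξ' hζ' hξ'' hζ''
  generalize u₁ - u' = e at *
  generalize u₁ - u₀ = s at *
  generalize v₁ - v' = f at *
  generalize v₁ - v₀ = t at *
  have hy : ∀ z, inner ℝ (x₀ - x') z = inner ℝ x₀ z - inner ℝ x' z := inner_sub_left x₀ x'
  generalize x₀ - x' = y at *
  rw [pair_sub, normSq_sub ha.Q_psd.isSymmetric, inner_apply_pair ha.Q_psd.isSymmetric] at h3
  rw [normSq_sub ha.D₁_psd.isSymmetric, normSq_sub ha.S_psd.isSymmetric,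
    normSq_sub ha.D₂_psd.isSymmetric, normSq_sub ha.T_psd.isSymmetric, map_sub P.Badj,
    norm_sub_sq_real, norm_add_sq_real, real_inner_smul_right, norm_smul, mul_pow,
    Real.norm_eq_abs, sq_abs, mul_add (a.τ * a.σ)⁻¹, mul_add (a.τ * a.σ)⁻¹]
  have hτσ₁ : (a.τ * a.σ)⁻¹ * (2 * (a.τ * a.σ * inner ℝ y r)) = 2 * inner ℝ y r := by
    have := ha.σ_pos.ne'
    have := ha.τ_pos.ne'
    field_simp
  have hτσ₂ : (a.τ * a.σ)⁻¹ * ((a.τ * a.σ) ^ 2 * ‖r‖ ^ 2) = a.τ * a.σ * ‖r‖ ^ 2 := by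
    have := ha.σ_pos.ne'
    have := ha.τ_pos.ne'
    field_simp
  rw [hτσ₁, hτσ₂, hy]
  rw [eq_sub_of_add_eq hr.symm] at h1
  simp only [inner_sub_left, inner_sub_right, real_inner_self_eq_norm_sq] at h1
  rw [real_inner_comm r (P.Badj t), real_inner_comm (P.Badj f) (P.Badj t)] at h1
  linarith

/-- Consecutive `v`-steps control the product of the residual with the increment of `B* v`. -/
theorem inner_residual_le (hP : P.Standing) (ha : a.Admissible P.φ) {η : ℝ}
    (hη : a.CrossControl P.φ η) {u₀ u₁ u₂ : U} {v₀ v₁ v₂ : V} {x₀ x₁ : X}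
    (h₁ : a.vSubgradient P u₀ u₁ v₀ v₁ x₀ ∈ subdifferential P.q v₁)
    (h₂ : a.vSubgradient P u₁ u₂ v₁ v₂ x₁ ∈ subdifferential P.q v₂)
    (hx : x₁ = x₀ + (a.τ * a.σ) • P.residual u₁ v₁) :
    a.σ * (inner ℝ (P.residual u₂ v₂) (P.Badj (v₂ - v₁))
        - (1 - a.τ) * inner ℝ (P.residual u₁ v₁) (P.Badj (v₂ - v₁)))
      ≤ 1 / 2 * (normSq a.T (v₁ - v₀) - normSq a.T (v₂ - v₁))
        + 1 / 2 * (normSq a.D₂ (v₁ - v₀) - normSq a.D₂ (v₂ - v₁))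
        - normSq (block22 a.Q) (v₂ - v₁) - inner ℝ (u₂ - u₁) (block12 a.Q (v₂ - v₁))
        + η / 2 * (normSq a.D₁ (u₁ - u₀) + normSq a.D₂ (v₂ - v₁)) := by
  have h := hP.q_convex.inner_subgradient_nonneg h₂ h₁
  rw [inner_sub_left, Params.inner_vSubgradient ha.Q_psd.isSymmetric,
    Params.inner_vSubgradient ha.Q_psd.isSymmetric] at h
  obtain ⟨W, hW₁, hW₂, hW, hgrad⟩ := exists_operator_gradient_sub hP ha hη (pair u₁ v₁) (pair u₀ v₀)
  have hWs : W.IsSymmetric := by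
    have := hW₁.isSymmetric.add ha.Q_psd.isSymmetric
    rwa [← ContinuousLinearMap.toLinearMap_add, sub_add_cancel] at this
  have hsnd : inner ℝ (gradient P.φ (pair u₁ v₁)).snd (v₂ - v₁)
      - inner ℝ (gradient P.φ (pair u₀ v₀)).snd (v₂ - v₁)
      = inner ℝ (u₁ - u₀) (block12 W (v₂ - v₁)) + inner ℝ (v₂ - v₁) (block22 W (v₁ - v₀)) := by
    have h1 := inner_apply_pair hWs (0 : U) (u₁ - u₀) (v₂ - v₁) (v₁ - v₀)
    rw [pair_sub u₁, ← hgrad, inner_pair_left, inner_zero_left, inner_zero_left, inner_zero_left,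
      zero_add, zero_add, zero_add] at h1
    rw [← h1, ← inner_sub_left, real_inner_comm]
    rfl
  -- The `v`-steps carry `Q₁₂` where the gradient increment carries `W₁₂`; the constant `η` bounds
  -- the mismatch.
  have hcross := (abs_le.1 (hW (u₁ - u₀) (v₂ - v₁))).1
  -- The lower right block of `Q + H - W` lies between `0` and `D₂`, so Young's inequality leaves
  -- squares in `D₂` that telescope.
  have hgap := two_mul_inner_le (isPositive_block22 hW₂) (v₂ - v₁) (v₁ - v₀)
  have hgap_le : ∀ b : V, normSq (block22 (a.Q + a.H - W)) b ≤ normSq a.D₂ b := by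
    intro b
    have h1 := normSq_nonneg hW₁ (pair 0 b)
    have h2 := Params.normSq_add_H_pair (a := a) 0 b
    rw [normSq_block22]
    simp only [normSq, sub_apply, inner_sub_right, inner_zero_left] at h1 h2 ⊢
    linarith
  have hgap_eq : inner ℝ (v₂ - v₁) (block22 (a.Q + a.H - W) (v₁ - v₀))
      = inner ℝ (v₂ - v₁) (block22 a.Q (v₁ - v₀)) + inner ℝ (v₂ - v₁) (a.D₂ (v₁ - v₀))
        - inner ℝ (v₂ - v₁) (block22 W (v₁ - v₀)) := by
    have h1 : block22 (a.Q + a.H - W) (v₁ - v₀)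
        = block22 a.Q (v₁ - v₀) + (a.H (pair 0 (v₁ - v₀))).snd - block22 W (v₁ - v₀) := rfl
    rw [h1, Params.H, blockDiag_apply, inner_sub_right, inner_add_right]
    rfl
  have hT := two_mul_inner_le ha.T_psd (v₂ - v₁) (v₁ - v₀)
  have hg₁ := hgap_le (v₂ - v₁)
  have hg₂ := hgap_le (v₁ - v₀)
  rw [sub_apply, inner_sub_right] at hcross
  rw [hgap_eq] at hgap
  -- The arguments of `B` in the two steps differ by `x₁ + σ r₂ - x₀ - σ r₁ = σ (r₂ - (1 - τ) r₁)`,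
  -- with `rᵢ` the residual at `(uᵢ, vᵢ)`; hence the factor `1 - τ`.
  rw [hx, inner_add_left, real_inner_smul_left] at h
  simp only [normSq] at *
  linarith

end Energy

/-! ### Convergence tools -/

section Tools

variable {E F : Type*} [NormedAddCommGroup E] [InnerProductSpace ℝ E]
  [NormedAddCommGroup F] [InnerProductSpace ℝ F]

theorem tendsto_zero_of_le_sub {Ψ D : ℕ → ℝ} (hΨ : ∀ k, 0 ≤ Ψ k) (hD : ∀ k, 0 ≤ D k)
    (h : ∀ k, D k ≤ Ψ k - Ψ (k + 1)) : Tendsto D atTop (𝓝 0) := by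
  have hanti : Antitone Ψ := antitone_nat_of_succ_le fun k => by linarith [hD k, h k]
  have hlim := tendsto_atTop_ciInf hanti ⟨0, by rintro _ ⟨k, rfl⟩; exact hΨ k⟩
  have hdiff := hlim.sub (hlim.comp (tendsto_add_atTop_nat 1))
  rw [sub_self] at hdiff
  exact squeeze_zero hD h hdiff

theorem tendsto_zero_of_mul_norm_sq_le {ι : Type*} {l : Filter ι} {y : ι → E} {f : ι → ℝ} {c : ℝ}
    (hc : 0 < c) (h : ∀ k, c * ‖y k‖ ^ 2 ≤ f k) (hf : Tendsto f l (𝓝 0)) :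
    Tendsto y l (𝓝 0) := by
  rw [tendsto_zero_iff_norm_tendsto_zero]
  have h1 : Tendsto (fun k => ‖y k‖ ^ 2) l (𝓝 0) := by
    refine squeeze_zero (fun k => sq_nonneg _) (fun k => ?_) (by simpa using hf.const_mul c⁻¹)
    rw [← div_eq_inv_mul, le_div_iff₀' hc]
    exact h k
  have h2 := h1.sqrt
  simpa using h2

theorem mem_closedBall_of_mul_norm_sq_le {y y' : E} {c M : ℝ} (hc : 0 < c)
    (h : c * ‖y - y'‖ ^ 2 ≤ M) : y ∈ Metric.closedBall y' √(c⁻¹ * M) := by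
  rw [mem_closedBall_iff_norm]
  refine Real.le_sqrt_of_sq_le ?_
  rw [← div_eq_inv_mul, le_div_iff₀' hc]
  exact h

theorem PosDef.exists_coercive [FiniteDimensional ℝ E] {G : E →L[ℝ] E} (hG : PosDef G) :
    ∃ c, 0 < c ∧ ∀ x, c * ‖x‖ ^ 2 ≤ normSq G x := by
  rcases subsingleton_or_nontrivial E with hE | hE
  · exact ⟨1, zero_lt_one, fun x => by simp [Subsingleton.elim x 0]⟩
  obtain ⟨z, hz, hmin⟩ := (isCompact_sphere (0 : E) 1).exists_isMinOn
    (NormedSpace.sphere_nonempty.2 zero_le_one) (continuous_normSq G).continuousOn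
  have hz0 : z ≠ 0 := by
    rintro rfl
    simp at hz
  refine ⟨normSq G z, hG.2 z hz0, fun x => ?_⟩
  rcases eq_or_ne x 0 with rfl | hx
  · simp
  have hx' : 0 < ‖x‖ := norm_pos_iff.2 hx
  have h1 : normSq G z ≤ normSq G (‖x‖⁻¹ • x) :=
    hmin (by simp [norm_smul, hx'.ne'])
  rw [normSq_smul] at h1
  calc normSq G z * ‖x‖ ^ 2 ≤ (‖x‖⁻¹ ^ 2 * normSq G x) * ‖x‖ ^ 2 := by gcongr
    _ = normSq G x := by field_simp

theorem normSq_sub_le {G : E →L[ℝ] E} (hG : G.IsPositive) (x y : E) :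
    normSq G (x - y) ≤ 2 * normSq G x + 2 * normSq G y := by
  have h := normSq_nonneg hG (x + y)
  rw [normSq_add hG.isSymmetric] at h
  rw [normSq_sub hG.isSymmetric]
  linarith

theorem norm_sub_sq_le (x y : E) : ‖x - y‖ ^ 2 ≤ 2 * ‖x‖ ^ 2 + 2 * ‖y‖ ^ 2 := by
  have h := sq_nonneg ‖x + y‖
  rw [norm_add_sq_real] at h
  rw [norm_sub_sq_real]
  linarith

/-- A bounded sequence of pairs tends to zero if a quadratic form which only vanishes when one
component vanishes tends to zero along it, and each component controls the other one. -/
theorem tendsto_zero_of_normSq_pair [FiniteDimensional ℝ E] [FiniteDimensional ℝ F]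
    {G : Prod2 E F →L[ℝ] Prod2 E F}
    (hG : ∀ w, inner ℝ w (G w) = 0 → ‖w.fst‖ * ‖w.snd‖ = 0) {s : ℕ → E} {t : ℕ → F} {R : ℝ}
    (hs : ∀ k, ‖s k‖ ≤ R) (ht : ∀ k, ‖t k‖ ≤ R)
    (hlim : Tendsto (fun k => normSq G (pair (s k) (t k))) atTop (𝓝 0))
    (hst : ∀ n : ℕ → ℕ, Tendsto n atTop atTop → Tendsto (s ∘ n) atTop (𝓝 0) →
      Tendsto (t ∘ n) atTop (𝓝 0))
    (hts : ∀ n : ℕ → ℕ, Tendsto n atTop atTop → Tendsto (t ∘ n) atTop (𝓝 0) →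
      Tendsto (s ∘ n) atTop (𝓝 0)) :
    Tendsto s atTop (𝓝 0) ∧ Tendsto t atTop (𝓝 0) := by
  have key : ∀ n : ℕ → ℕ, Tendsto n atTop atTop → ∃ m : ℕ → ℕ,
      Tendsto (fun k => s (n (m k))) atTop (𝓝 0) ∧ Tendsto (fun k => t (n (m k))) atTop (𝓝 0) := by
    intro n hn
    obtain ⟨z, -, m, hm, hz⟩ := ((isCompact_closedBall (0 : E) R).prod
      (isCompact_closedBall (0 : F) R)).tendsto_subseq (x := fun k => (s (n k), t (n k)))
      fun k => ⟨by simpa using hs _, by simpa using ht _⟩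
    have hz1 : Tendsto (s ∘ n ∘ m) atTop (𝓝 z.1) := (continuous_fst.tendsto z).comp hz
    have hz2 : Tendsto (t ∘ n ∘ m) atTop (𝓝 z.2) := (continuous_snd.tendsto z).comp hz
    have hnm : Tendsto (n ∘ m) atTop atTop := hn.comp hm.tendsto_atTop
    have hpair : Continuous fun z : E × F => normSq G (pair z.1 z.2) :=
      (continuous_normSq G).comp (WithLp.prod_continuous_toLp 2 E F)
    have h0 : normSq G (pair z.1 z.2) = 0 :=
      tendsto_nhds_unique ((hpair.tendsto z).comp hz) (hlim.comp hnm)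
    refine ⟨m, ?_⟩
    rcases mul_eq_zero.1 (hG _ h0) with h | h
    · have h' : z.1 = 0 := norm_eq_zero.1 h
      rw [h'] at hz1
      exact ⟨hz1, hst _ hnm hz1⟩
    · have h' : z.2 = 0 := norm_eq_zero.1 h
      rw [h'] at hz2
      exact ⟨hts _ hnm hz2, hz2⟩
  exact ⟨tendsto_of_subseq_tendsto fun n hn => (key n hn).imp fun _ h => h.1,
    tendsto_of_subseq_tendsto fun n hn => (key n hn).imp fun _ h => h.2⟩

end Tools

/-! ### From a merit function to convergence -/

section Merit

variable {U V X : Type*}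
  [NormedAddCommGroup U] [InnerProductSpace ℝ U] [FiniteDimensional ℝ U]
  [NormedAddCommGroup V] [InnerProductSpace ℝ V] [FiniteDimensional ℝ V]
  [NormedAddCommGroup X] [InnerProductSpace ℝ X] [FiniteDimensional ℝ X]
  {P : Problem U V X} {a : Params U V}

theorem continuous_gradient (hP : P.Standing) : Continuous (gradient P.φ) :=
  let ⟨_, hL⟩ := hP.φ_lipschitz
  hL.continuous

theorem continuous_pair : Continuous fun z : U × V => pair z.1 z.2 :=
  WithLp.prod_continuous_toLp 2 U V

theorem Problem.continuous_residual (P : Problem U V X) :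
    Continuous fun z : U × V => P.residual z.1 z.2 := by
  unfold Problem.residual
  fun_prop

theorem continuous_withLp_fst : Continuous fun z : Prod2 U V => z.fst :=
  (WithLp.fstL 2 ℝ U V).continuous

theorem continuous_withLp_snd : Continuous fun z : Prod2 U V => z.snd :=
  (WithLp.sndL 2 ℝ U V).continuous

theorem Params.continuous_uSubgradient (hP : P.Standing) :
    Continuous fun z : (U × U) × V × X => a.uSubgradient P z.1.1 z.1.2 z.2.1 z.2.2 := by
  have h0 : Continuous fun z : (U × U) × V × X => pair z.1.1 z.2.1 :=
    continuous_pair.comp (by fun_prop : Continuous fun z : (U × U) × V × X => (z.1.1, z.2.1))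
  have h1 : Continuous fun z : (U × U) × V × X => (gradient P.φ (pair z.1.1 z.2.1)).fst :=
    continuous_withLp_fst.comp ((continuous_gradient hP).comp h0)
  have h2 : Continuous fun z : (U × U) × V × X => P.residual z.1.2 z.2.1 := by
    unfold Problem.residual
    fun_prop
  have h3 : Continuous fun z : (U × U) × V × X => z.1.2 - z.1.1 := by fun_prop
  have h4 : Continuous fun z : (U × U) × V × X => z.2.2 := by fun_prop
  exact ((((h1.add ((block11 a.Q).continuous.comp h3)).add (a.D₁.continuous.comp h3)).add
    (P.A.continuous.comp (h4.add (h2.const_smul a.σ)))).add (a.S.continuous.comp h3)).neg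

theorem Params.continuous_vSubgradient (hP : P.Standing) :
    Continuous fun z : (U × U) × (V × V) × X =>
      a.vSubgradient P z.1.1 z.1.2 z.2.1.1 z.2.1.2 z.2.2 := by
  have h0 : Continuous fun z : (U × U) × (V × V) × X => pair z.1.1 z.2.1.1 :=
    continuous_pair.comp
      (by fun_prop : Continuous fun z : (U × U) × (V × V) × X => (z.1.1, z.2.1.1))
  have h1 : Continuous fun z : (U × U) × (V × V) × X => (gradient P.φ (pair z.1.1 z.2.1.1)).snd :=
    continuous_withLp_snd.comp ((continuous_gradient hP).comp h0)
  have h2 : Continuous fun z : (U × U) × (V × V) × X => P.residual z.1.2 z.2.1.2 := by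
    unfold Problem.residual
    fun_prop
  have h3 : Continuous fun z : (U × U) × (V × V) × X => z.2.1.2 - z.2.1.1 := by fun_prop
  have h4 : Continuous fun z : (U × U) × (V × V) × X => z.2.2 := by fun_prop
  have h5 : Continuous fun z : (U × U) × (V × V) × X =>
      pair (z.1.2 - z.1.1) (z.2.1.2 - z.2.1.1) :=
    continuous_pair.comp (by fun_prop : Continuous fun z : (U × U) × (V × V) × X =>
      (z.1.2 - z.1.1, z.2.1.2 - z.2.1.1))
  exact ((((h1.add (continuous_withLp_snd.comp (a.Q.continuous.comp h5))).add
    (a.D₂.continuous.comp h3)).add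
    (P.B.continuous.comp (h4.add (h2.const_smul a.σ)))).add (a.T.continuous.comp h3)).neg

variable {u : ℕ → U} {v : ℕ → V} {x : ℕ → X}

/-- Cluster points of the iterates are Karush-Kuhn-Tucker points once the increments and the
residuals vanish asymptotically. -/
theorem Params.IsGenerated.isKKT_of_tendsto (hgen : a.IsGenerated P u v x) (hP : P.Standing)
    (ha : a.Admissible P.φ) (hΔu : Tendsto (fun k => u (k + 1) - u k) atTop (𝓝 0))
    (hΔv : Tendsto (fun k => v (k + 1) - v k) atTop (𝓝 0))
    (hr : Tendsto (fun k => P.residual (u k) (v k)) atTop (𝓝 0)) {n : ℕ → ℕ}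
    (hn : Tendsto n atTop atTop) {u' : U} {v' : V} {x' : X}
    (hu : Tendsto (u ∘ n) atTop (𝓝 u')) (hv : Tendsto (v ∘ n) atTop (𝓝 v'))
    (hx : Tendsto (x ∘ n) atTop (𝓝 x')) : P.IsKKT u' v' x' := by
  have hu1 : Tendsto (fun i => u (n i + 1)) atTop (𝓝 u') := by
    have := (hΔu.comp hn).add hu
    rw [zero_add] at this
    exact this.congr fun i => sub_add_cancel _ _
  have hv1 : Tendsto (fun i => v (n i + 1)) atTop (𝓝 v') := by
    have := (hΔv.comp hn).add hv
    rw [zero_add] at this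
    exact this.congr fun i => sub_add_cancel _ _
  have hres : P.residual u' v' = 0 :=
    tendsto_nhds_unique ((P.continuous_residual.tendsto (u', v')).comp (hu.prodMk_nhds hv))
      (hr.comp hn)
  -- Consecutive iterates share their limit, so all increment terms in the selected subgradients
  -- disappear and the closed graph leaves the KKT inclusions.
  have h1 := hP.p_convex.mem_subdifferential_of_tendsto hu1
    (((Params.continuous_uSubgradient (a := a) hP).tendsto ((u', u'), v', x')).comp
      ((hu.prodMk_nhds hu1).prodMk_nhds (hv.prodMk_nhds hx)))
    fun i => hgen.uSubgradient_mem hP ha (n i)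
  have h2 := hP.q_convex.mem_subdifferential_of_tendsto hv1
    (((Params.continuous_vSubgradient (a := a) hP).tendsto ((u', u'), (v', v'), x')).comp
      ((hu.prodMk_nhds hu1).prodMk_nhds ((hv.prodMk_nhds hv1).prodMk_nhds hx)))
    fun i => hgen.vSubgradient_mem hP ha (n i)
  have h0 : (a.Q (pair (0 : U) (0 : V))).snd = 0 := by
    have : pair (0 : U) (0 : V) = 0 := rfl
    rw [this, map_zero]
    rfl
  refine ⟨⟨_, h1, ?_⟩, ⟨_, h2, ?_⟩, sub_eq_zero.1 hres⟩
  · simp only [Params.uSubgradient, hres, sub_self, map_zero, smul_zero, add_zero]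
    abel
  · simp only [Params.vSubgradient, hres, sub_self, map_zero, smul_zero, add_zero, h0]
    abel

/-- A nonincreasing merit function which dominates the distance to each Karush-Kuhn-Tucker point
and vanishes along subsequences converging to it forces convergence of the iterates. -/
theorem Params.IsGenerated.convergesToSolution_of_merit (hgen : a.IsGenerated P u v x)
    (hP : P.Standing) (ha : a.Admissible P.φ) {η : ℝ} (hη : a.CrossControl P.φ η)
    (hKKT : ∃ u' v' x', P.IsKKT u' v' x')
    (hΔu : Tendsto (fun k => u (k + 1) - u k) atTop (𝓝 0))
    (hΔv : Tendsto (fun k => v (k + 1) - v k) atTop (𝓝 0))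
    (hr : Tendsto (fun k => P.residual (u k) (v k)) atTop (𝓝 0))
    (Ψ : U → V → X → ℕ → ℝ)
    (hanti : ∀ u' v' x', P.IsKKT u' v' x' → Antitone (Ψ u' v' x'))
    (hcoer : ∀ u' v' x', P.IsKKT u' v' x' → ∃ c, 0 < c ∧ ∀ k, c * ‖u (k + 2) - u'‖ ^ 2
      ≤ Ψ u' v' x' k ∧ c * ‖v (k + 1) - v'‖ ^ 2 ≤ Ψ u' v' x' k
      ∧ c * ‖x (k + 1) - x'‖ ^ 2 ≤ Ψ u' v' x' k)
    (hzero : ∀ u' v' x', P.IsKKT u' v' x' → ∀ n : ℕ → ℕ, Tendsto n atTop atTop →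
      Tendsto (fun i => u (n i + 1)) atTop (𝓝 u') → Tendsto (fun i => v (n i + 1)) atTop (𝓝 v') →
      Tendsto (fun i => x (n i + 1)) atTop (𝓝 x') →
      Tendsto (fun i => Ψ u' v' x' (n i)) atTop (𝓝 0)) :
    ConvergesToSolution P u v x := by
  obtain ⟨u', v', x', hK⟩ := hKKT
  obtain ⟨c, hc, hle⟩ := hcoer u' v' x' hK
  have hle0 : ∀ k, Ψ u' v' x' k ≤ Ψ u' v' x' 0 := fun k => hanti u' v' x' hK (Nat.zero_le k)
  -- The merit value at `k` bounds `u` at `k + 2` but `v` and `x` at `k + 1`; the latter two use the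
  -- value at `k + 1` to reach a common index.
  obtain ⟨z, -, n, hn, hz⟩ := ((isCompact_closedBall u' √(c⁻¹ * Ψ u' v' x' 0)).prod
    ((isCompact_closedBall v' √(c⁻¹ * Ψ u' v' x' 0)).prod
      (isCompact_closedBall x' √(c⁻¹ * Ψ u' v' x' 0)))).tendsto_subseq
    (x := fun k => (u (k + 2), v (k + 2), x (k + 2))) fun k =>
      ⟨mem_closedBall_of_mul_norm_sq_le hc ((hle k).1.trans (hle0 k)),
        mem_closedBall_of_mul_norm_sq_le hc ((hle (k + 1)).2.1.trans (hle0 (k + 1))),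
        mem_closedBall_of_mul_norm_sq_le hc ((hle (k + 1)).2.2.trans (hle0 (k + 1)))⟩
  have hzu : Tendsto (fun i => u (n i + 1 + 1)) atTop (𝓝 z.1) := (continuous_fst.tendsto z).comp hz
  have hzv : Tendsto (fun i => v (n i + 1 + 1)) atTop (𝓝 z.2.1) :=
    ((continuous_fst.comp continuous_snd).tendsto z).comp hz
  have hzx : Tendsto (fun i => x (n i + 1 + 1)) atTop (𝓝 z.2.2) :=
    ((continuous_snd.comp continuous_snd).tendsto z).comp hz
  have hn1 : Tendsto (fun i => n i + 1) atTop atTop :=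
    (tendsto_add_atTop_nat 1).comp hn.tendsto_atTop
  have hn2 : Tendsto (fun i => n i + 1 + 1) atTop atTop :=
    (tendsto_add_atTop_nat 1).comp hn1
  have hK' : P.IsKKT z.1 z.2.1 z.2.2 :=
    hgen.isKKT_of_tendsto hP ha hΔu hΔv hr hn2 hzu hzv hzx
  -- The merit function is re-centred at the cluster point: being monotone, it tends to zero as soon
  -- as a subsequence does.
  have hΨ : Tendsto (Ψ z.1 z.2.1 z.2.2) atTop (𝓝 0) :=
    (tendsto_iff_tendsto_subseq_of_antitone (hanti _ _ _ hK') hn1).2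
      (hzero _ _ _ hK' _ hn1 hzu hzv hzx)
  obtain ⟨c', hc', hle'⟩ := hcoer _ _ _ hK'
  have hu := tendsto_zero_of_mul_norm_sq_le hc' (fun k => (hle' k).1) hΨ
  have hv := tendsto_zero_of_mul_norm_sq_le hc' (fun k => (hle' k).2.1) hΨ
  have hx := tendsto_zero_of_mul_norm_sq_le hc' (fun k => (hle' k).2.2) hΨ
  have hu' : Tendsto u atTop (𝓝 z.1) :=
    (tendsto_add_atTop_iff_nat 2).1 (tendsto_sub_nhds_zero_iff.1 hu)
  have hv' : Tendsto v atTop (𝓝 z.2.1) :=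
    (tendsto_add_atTop_iff_nat 1).1 (tendsto_sub_nhds_zero_iff.1 hv)
  have hx' : Tendsto x atTop (𝓝 z.2.2) :=
    (tendsto_add_atTop_iff_nat 1).1 (tendsto_sub_nhds_zero_iff.1 hx)
  exact ⟨z.1, z.2.1, z.2.2, P.isSolution_of_isKKT hP ha hη hK', hK', hu'.prodMk_nhds hv', hx'⟩

end Merit

/-! ### Short steps -/

section ShortStep

variable {U V X : Type*}
  [NormedAddCommGroup U] [InnerProductSpace ℝ U] [FiniteDimensional ℝ U]
  [NormedAddCommGroup V] [InnerProductSpace ℝ V] [FiniteDimensional ℝ V]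
  [NormedAddCommGroup X] [InnerProductSpace ℝ X] [FiniteDimensional ℝ X]
  {P : Problem U V X} {a : Params U V}

theorem Problem.normSq_AAadj (P : Problem U V X) (u : U) :
    normSq (P.A ∘L P.Aadj) u = ‖P.Aadj u‖ ^ 2 := by
  rw [normSq, ← real_inner_self_eq_norm_sq, ← P.inner_A, real_inner_comm]
  rfl

theorem Problem.normSq_BBadj (P : Problem U V X) (v : V) :
    normSq (P.B ∘L P.Badj) v = ‖P.Badj v‖ ^ 2 := by
  rw [normSq, ← real_inner_self_eq_norm_sq, ← P.inner_B, real_inner_comm]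
  rfl

section

variable {E : Type*} [NormedAddCommGroup E] [InnerProductSpace ℝ E]

theorem normSq_add_left (G G' : E →L[ℝ] E) (y : E) :
    normSq (G + G') y = normSq G y + normSq G' y := by
  simp [normSq, inner_add_right]

theorem normSq_sub_left (G G' : E →L[ℝ] E) (y : E) :
    normSq (G - G') y = normSq G y - normSq G' y := by
  simp [normSq, inner_sub_right]

theorem normSq_smul_left (r : ℝ) (G : E →L[ℝ] E) (y : E) :
    normSq (r • G) y = r * normSq G y := by
  simp [normSq, inner_smul_right]

end

theorem Params.continuous_energy (u' : U) (v' : V) (x' : X) :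
    Continuous fun z : U × V × X => a.energy P u' v' x' z.1 z.2.1 z.2.2 := by
  unfold energy normSq
  fun_prop

theorem Params.tendsto_energy {ι : Type*} {l : Filter ι} {u : ι → U} {v : ι → V} {x : ι → X}
    {u' : U} {v' : V} {x' : X} (hu : Tendsto u l (𝓝 u')) (hv : Tendsto v l (𝓝 v'))
    (hx : Tendsto x l (𝓝 x')) :
    Tendsto (fun i => a.energy P u' v' x' (u i) (v i) (x i)) l (𝓝 0) := by
  have h := ((a.continuous_energy (P := P) u' v' x').tendsto (u', v', x')).comp
    (hu.prodMk_nhds (hv.prodMk_nhds hx))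
  have h0 : a.energy P u' v' x' u' v' x' = 0 := by simp [energy]
  simp only [h0] at h
  exact h

theorem tendsto_normSq_sub {E ι : Type*} [NormedAddCommGroup E] [InnerProductSpace ℝ E]
    (G : E →L[ℝ] E) {l : Filter ι} {y : ι → E} {y' : E} (h : Tendsto y l (𝓝 y')) :
    Tendsto (fun i => normSq G (y i - y')) l (𝓝 0) := by
  have := ((continuous_normSq G).tendsto _).comp (tendsto_sub_nhds_zero_iff.2 h)
  rwa [normSq_zero] at this

theorem tendsto_norm_sq_apply {E F ι : Type*} [NormedAddCommGroup E] [NormedSpace ℝ E]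
    [NormedAddCommGroup F] [NormedSpace ℝ F] (G : E →L[ℝ] F) {l : Filter ι} {y : ι → E}
    (h : Tendsto y l (𝓝 0)) : Tendsto (fun i => ‖G (y i)‖ ^ 2) l (𝓝 0) := by
  simpa using ((G.continuous.tendsto 0).comp h).norm.pow 2

/-- Disposes of the indefinite cross term of `energy_descent` when `e = u₁ - u'`, `f = v₁ - v'` and
`f - t = v₀ - v'`: the last two terms telescope and the first two are nonnegative for `Q ⪰ 0`. -/
theorem normSq_pair_cross {Q : Prod2 U V →L[ℝ] Prod2 U V} (hQ : Q.IsSymmetric) (e : U) (f t : V) :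
    normSq Q (pair e f) - inner ℝ e (block12 Q t) = 1 / 2 * normSq Q (pair e f)
      + 1 / 2 * normSq Q (pair e (f - t)) + 1 / 2 * normSq (block22 Q) f
      - 1 / 2 * normSq (block22 Q) (f - t) := by
  rw [normSq_pair hQ, normSq_pair hQ, map_sub, inner_sub_right]
  ring

/-- A coercivity estimate for the energy augmented by `Q₂₂`. -/
theorem Params.exists_coercive (ha : a.Admissible P.φ)
    (hpd₁ : PosDef (block11 a.Q + a.σ • (P.A ∘L P.Aadj) + a.S))
    (hpd₂ : PosDef (block22 a.Q + a.σ • (P.B ∘L P.Badj) + a.T)) :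
    ∃ c, 0 < c ∧ (∀ (u' : U) (v' : V) (x' : X) (u : U) (v : V) (x : X),
      c * ‖v - v'‖ ^ 2 ≤ a.energy P u' v' x' u v x + 1 / 2 * normSq (block22 a.Q) (v - v') ∧
      c * ‖x - x'‖ ^ 2 ≤ a.energy P u' v' x' u v x + 1 / 2 * normSq (block22 a.Q) (v - v')) ∧
      (∀ e : U, c * ‖e‖ ^ 2 ≤ normSq (block11 a.Q) e + a.σ * ‖P.Aadj e‖ ^ 2 + normSq a.S e) ∧
      ∀ f : V, c * ‖f‖ ^ 2 ≤ normSq (block22 a.Q) f + a.σ * ‖P.Badj f‖ ^ 2 + normSq a.T f := by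
  obtain ⟨c₁, hc₁, h₁⟩ := hpd₁.exists_coercive
  obtain ⟨c₂, hc₂, h₂⟩ := hpd₂.exists_coercive
  simp only [normSq_add_left, normSq_smul_left, P.normSq_AAadj] at h₁
  simp only [normSq_add_left, normSq_smul_left, P.normSq_BBadj] at h₂
  have hσ := ha.σ_pos
  have hτ := ha.τ_pos
  -- The halves match the factor `1 / 2` in the energy. There is no such bound for `u`, whose weight
  -- in the energy is only `D₁ + S`.
  set c := min c₁ (min (c₂ / 2) ((a.τ * a.σ)⁻¹ / 2)) with hc
  have hle₁ : c ≤ c₁ := min_le_left _ _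
  have hle₂ : c ≤ c₂ / 2 := (min_le_right _ _).trans (min_le_left _ _)
  have hle₃ : c ≤ (a.τ * a.σ)⁻¹ / 2 := (min_le_right _ _).trans (min_le_right _ _)
  refine ⟨c, by positivity, fun u' v' x' u v x => ?_, fun e => ?_, fun f => ?_⟩
  · have h3 := h₂ (v - v')
    have h4 := mul_le_mul_of_nonneg_right hle₂ (sq_nonneg ‖v - v'‖)
    have h5 := mul_le_mul_of_nonneg_right hle₃ (sq_nonneg ‖x - x'‖)
    have h6 := normSq_nonneg ha.D₁_psd (u - u')
    have h7 := normSq_nonneg ha.S_psd (u - u')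
    have h8 := normSq_nonneg ha.D₂_psd (v - v')
    have h9 := normSq_nonneg ha.T_psd (v - v')
    have h10 := normSq_nonneg (isPositive_block22 ha.Q_psd) (v - v')
    have h11 : 0 ≤ (a.τ * a.σ)⁻¹ * ‖x - x'‖ ^ 2 := by positivity
    have h12 : 0 ≤ a.σ * ‖P.Badj (v - v')‖ ^ 2 := by positivity
    rw [energy]
    constructor <;> linarith
  · exact (mul_le_mul_of_nonneg_right hle₁ (sq_nonneg _)).trans (h₁ e)
  · have h4 := mul_le_mul_of_nonneg_right hle₂ (sq_nonneg ‖f‖)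
    have h3 := h₂ f
    have h5 : 0 ≤ c₂ * ‖f‖ ^ 2 := by positivity
    linarith

/-- The terms summed up in the descent estimate for short steps. -/
def Params.shortStepGap (a : Params U V) (P : Problem U V X) (u' : U) (v' : V) (u₀ u₁ : U)
    (v₀ v₁ : V) : ℝ :=
  1 / 2 * normSq a.Q (pair (u₁ - u') (v₀ - v')) + 1 / 2 * normSq a.S (u₁ - u₀)
    + 1 / 2 * normSq a.T (v₁ - v₀) + a.σ / 2 * ‖P.residual u₁ v₀‖ ^ 2
    + (1 - a.τ) * (a.σ / 2 * ‖P.residual u₁ v₁‖ ^ 2)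

theorem Params.shortStepGap_bounds (ha : a.Admissible P.φ) (hτ : a.τ ≤ 1) (u' : U) (v' : V)
    (u₀ u₁ : U) (v₀ v₁ : V) :
    0 ≤ a.shortStepGap P u' v' u₀ u₁ v₀ v₁ ∧
    normSq a.Q (pair (u₁ - u') (v₀ - v')) ≤ 2 * a.shortStepGap P u' v' u₀ u₁ v₀ v₁ ∧
    normSq a.S (u₁ - u₀) ≤ 2 * a.shortStepGap P u' v' u₀ u₁ v₀ v₁ ∧
    normSq a.T (v₁ - v₀) ≤ 2 * a.shortStepGap P u' v' u₀ u₁ v₀ v₁ ∧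
    a.σ * ‖P.residual u₁ v₀‖ ^ 2 ≤ 2 * a.shortStepGap P u' v' u₀ u₁ v₀ v₁ ∧
    (1 - a.τ) * (a.σ * ‖P.residual u₁ v₁‖ ^ 2) ≤ 2 * a.shortStepGap P u' v' u₀ u₁ v₀ v₁ := by
  have h1 := normSq_nonneg ha.Q_psd (pair (u₁ - u') (v₀ - v'))
  have h2 := normSq_nonneg ha.S_psd (u₁ - u₀)
  have h3 := normSq_nonneg ha.T_psd (v₁ - v₀)
  have hσ := ha.σ_pos
  have h4 : 0 ≤ a.σ * ‖P.residual u₁ v₀‖ ^ 2 := by positivity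
  have h5 : 0 ≤ (1 - a.τ) * (a.σ * ‖P.residual u₁ v₁‖ ^ 2) :=
    mul_nonneg (sub_nonneg.2 hτ) (by positivity)
  unfold shortStepGap
  refine ⟨?_, ?_, ?_, ?_, ?_, ?_⟩ <;> linarith

variable {u : ℕ → U} {v : ℕ → V} {x : ℕ → X}

/-- With `r` the new residual and `y = B* Δv`, `(2 - τ)‖r‖² - 2⟨r, y⟩ + ‖y‖² = ‖r - y‖² + (1 -
τ)‖r‖²`, and `r - y` is the residual at the new `u` and old `v`. One of the two `Q`-squares from
`normSq_pair_cross` is discarded. -/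
theorem Params.IsGenerated.shortStepGap_le (hgen : a.IsGenerated P u v x) (hP : P.Standing)
    (ha : a.Admissible P.φ) {η : ℝ} (hη : a.CrossControl P.φ η) {u' : U} {v' : V} {x' : X}
    (hK : P.IsKKT u' v' x') (k : ℕ) :
    a.shortStepGap P u' v' (u k) (u (k + 1)) (v k) (v (k + 1))
      ≤ (a.energy P u' v' x' (u k) (v k) (x k) + 1 / 2 * normSq (block22 a.Q) (v k - v'))
        - (a.energy P u' v' x' (u (k + 1)) (v (k + 1)) (x (k + 1))
          + 1 / 2 * normSq (block22 a.Q) (v (k + 1) - v')) := by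
  have h := energy_descent hP ha hη hK (hgen.uSubgradient_mem hP ha k)
    (hgen.vSubgradient_mem hP ha k) (hgen.step_x k)
  rw [normSq_pair_cross ha.Q_psd.isSymmetric, sub_sub_sub_cancel_left] at h
  have h1 := normSq_nonneg ha.Q_psd (pair (u (k + 1) - u') (v (k + 1) - v'))
  have h2 := P.residual_sub_right (u (k + 1)) (v (k + 1)) (v k)
  rw [Params.shortStepGap, h2, norm_sub_sq_real]
  linarith

/-- Convergence of the majorized ADMM for step lengths at most one. -/
theorem Params.IsGenerated.convergesToSolution_of_le_one (hgen : a.IsGenerated P u v x)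
    (hP : P.Standing) (ha : a.Admissible P.φ) {η : ℝ} (hη : a.CrossControl P.φ η)
    (hKKT : ∃ u' v' x', P.IsKKT u' v' x')
    (hpd₁ : PosDef (block11 a.Q + a.σ • (P.A ∘L P.Aadj) + a.S))
    (hpd₂ : PosDef (block22 a.Q + a.σ • (P.B ∘L P.Badj) + a.T)) (hτ : a.τ ≤ 1)
    (hcond : ∀ w : Prod2 U V, inner ℝ w ((a.Q + blockDiag
      (a.S + ((1 - a.τ) * a.σ) • (P.A ∘L P.Aadj))
      (a.T + ((1 - a.τ) * a.σ) • (P.B ∘L P.Badj))) w) = 0 → ‖w.fst‖ * ‖w.snd‖ = 0) :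
    ConvergesToSolution P u v x := by
  have hσ := ha.σ_pos
  have hτ0 := ha.τ_pos
  have hτ1 : 0 ≤ 1 - a.τ := sub_nonneg.2 hτ
  have hτ2 : 1 - a.τ ≤ 1 := by linarith
  obtain ⟨c, hc, hcE, hcU, hcV⟩ := Params.exists_coercive ha hpd₁ hpd₂
  set Ψ : U → V → X → ℕ → ℝ := fun u' v' x' k =>
    a.energy P u' v' x' (u k) (v k) (x k) + 1 / 2 * normSq (block22 a.Q) (v k - v') with hΨ
  set D : U → V → ℕ → ℝ := fun u' v' k =>
    a.shortStepGap P u' v' (u k) (u (k + 1)) (v k) (v (k + 1)) with hD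
  have hDb := fun u' v' k =>
    Params.shortStepGap_bounds ha hτ u' v' (u k) (u (k + 1)) (v k) (v (k + 1))
  have hdesc : ∀ u' v' x', P.IsKKT u' v' x' → ∀ k, D u' v' k ≤ Ψ u' v' x' k - Ψ u' v' x' (k + 1) :=
    fun u' v' x' hK k => hgen.shortStepGap_le hP ha hη hK k
  have hΨ0 : ∀ u' v' x' k, 0 ≤ Ψ u' v' x' k := fun u' v' x' k =>
    add_nonneg (Params.energy_nonneg ha _ _ _ _ _ _)
      (mul_nonneg (by norm_num) (normSq_nonneg (isPositive_block22 ha.Q_psd) _))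
  have hanti : ∀ u' v' x', P.IsKKT u' v' x' → Antitone (Ψ u' v' x') := fun u' v' x' hK =>
    antitone_nat_of_succ_le fun k => by linarith [(hDb u' v' k).1, hdesc u' v' x' hK k]
  -- The energy alone does not control `u`; the gap `D u' v' k ≤ Ψ u' v' x' k` supplies the missing
  -- `Q` and residual terms for `u (k + 1)`. The contributions total at most `12 Ψ`, so 18 is a
  -- generous factor.
  have hcoer : ∀ u' v' x', P.IsKKT u' v' x' → ∀ k, c / 18 * ‖u (k + 1) - u'‖ ^ 2
      ≤ Ψ u' v' x' k ∧ c / 18 * ‖v k - v'‖ ^ 2 ≤ Ψ u' v' x' k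
      ∧ c / 18 * ‖x k - x'‖ ^ 2 ≤ Ψ u' v' x' k := by
    intro u' v' x' hK k
    have h1 : c * ‖v k - v'‖ ^ 2 ≤ Ψ u' v' x' k ∧ c * ‖x k - x'‖ ^ 2 ≤ Ψ u' v' x' k :=
      hcE u' v' x' (u k) (v k) (x k)
    refine ⟨?_, ?_, ?_⟩
    · have hd := hdesc u' v' x' hK k
      obtain ⟨-, hb1, -, -, hb4, -⟩ := hDb u' v' k
      have hp : pair (u (k + 1) - u') (0 : V)
          = pair (u (k + 1) - u') (v k - v') - pair 0 (v k - v') := by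
        rw [← pair_sub, sub_zero, sub_self]
      have hA : P.Aadj (u (k + 1) - u') = P.residual (u (k + 1)) (v k) - P.Badj (v k - v') := by
        rw [P.residual_eq hK.2.2]
        abel
      have h2 := hcU (u (k + 1) - u')
      have h3 := normSq_sub_le ha.Q_psd (pair (u (k + 1) - u') (v k - v')) (pair 0 (v k - v'))
      rw [← hp, ← normSq_block11, ← normSq_block22] at h3
      have h4 := norm_sub_sq_le (P.residual (u (k + 1)) (v k)) (P.Badj (v k - v'))
      rw [← hA] at h4
      have h5 := mul_le_mul_of_nonneg_left h4 hσ.le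
      have hS : normSq a.S (u (k + 1) - u') ≤ 2 * Ψ u' v' x' (k + 1) := by
        simp only [hΨ, Params.energy]
        have h6 := normSq_nonneg ha.D₁_psd (u (k + 1) - u')
        have h8 := normSq_nonneg ha.D₂_psd (v (k + 1) - v')
        have h9 := normSq_nonneg ha.T_psd (v (k + 1) - v')
        have h10 := normSq_nonneg (isPositive_block22 ha.Q_psd) (v (k + 1) - v')
        have h11 : 0 ≤ (a.τ * a.σ)⁻¹ * ‖x (k + 1) - x'‖ ^ 2 := by positivity
        have h12 : 0 ≤ a.σ * ‖P.Badj (v (k + 1) - v')‖ ^ 2 := by positivity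
        linarith
      have hB : normSq (block22 a.Q) (v k - v') + a.σ * ‖P.Badj (v k - v')‖ ^ 2
          ≤ 2 * Ψ u' v' x' k := by
        simp only [hΨ, Params.energy]
        have h6 := normSq_nonneg ha.D₁_psd (u k - u')
        have h7 := normSq_nonneg ha.S_psd (u k - u')
        have h8 := normSq_nonneg ha.D₂_psd (v k - v')
        have h9 := normSq_nonneg ha.T_psd (v k - v')
        have h11 : 0 ≤ (a.τ * a.σ)⁻¹ * ‖x k - x'‖ ^ 2 := by positivity
        linarith
      have hd0 := (hDb u' v' k).1
      have hΨk := hΨ0 u' v' x' (k + 1)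
      linarith
    · have : 0 ≤ c * ‖v k - v'‖ ^ 2 := by positivity
      linarith [h1.1]
    · have : 0 ≤ c * ‖x k - x'‖ ^ 2 := by positivity
      linarith [h1.2]
  -- The gap controls the staggered points `(u (k + 1), v k)`, so the increment of `u` is paired
  -- with the preceding increment of `v`.
  have hsteps : Tendsto (fun k => u (k + 1 + 1) - u (k + 1)) atTop (𝓝 0) ∧
      Tendsto (fun k => v (k + 1) - v k) atTop (𝓝 0) ∧
      Tendsto (fun k => P.residual (u (k + 1)) (v k)) atTop (𝓝 0) := by
    obtain ⟨u', v', x', hK⟩ := hKKT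
    have hDlim : Tendsto (D u' v') atTop (𝓝 0) :=
      tendsto_zero_of_le_sub (hΨ0 u' v' x') (fun k => (hDb u' v' k).1) (hdesc u' v' x' hK)
    -- A crude common majorant: the estimates below add up to at most `38 D k + 14 D (k + 1)`.
    have hDD : Tendsto (fun k => 100 * (D u' v' k + D u' v' (k + 1))) atTop (𝓝 0) := by
      have := (hDlim.add (hDlim.comp (tendsto_add_atTop_nat 1))).const_mul 100
      simpa using this
    have hres : Tendsto (fun k => P.residual (u (k + 1)) (v k)) atTop (𝓝 0) :=
      tendsto_zero_of_mul_norm_sq_le hσ (fun k => (hDb u' v' k).2.2.2.2.1)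
        (by simpa using hDlim.const_mul 2)
    have hR : ∀ k, ‖u (k + 1) - u'‖ ≤ √((c / 18)⁻¹ * Ψ u' v' x' 0) ∧
        ‖v k - v'‖ ≤ √((c / 18)⁻¹ * Ψ u' v' x' 0) := by
      intro k
      have h0 := hanti u' v' x' hK (Nat.zero_le k)
      have h1 := hcoer u' v' x' hK k
      have hc18 : 0 < c / 18 := by positivity
      exact ⟨mem_closedBall_iff_norm.1 (mem_closedBall_of_mul_norm_sq_le hc18 (h1.1.trans h0)),
        mem_closedBall_iff_norm.1 (mem_closedBall_of_mul_norm_sq_le hc18 (h1.2.1.trans h0))⟩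
    -- the sum of the images of the increments under the constraint operators
    have hsum : ∀ k, a.σ * ‖P.Aadj (u (k + 1 + 1) - u (k + 1)) + P.Badj (v (k + 1) - v k)‖ ^ 2
        ≤ 4 * D u' v' k + 4 * D u' v' (k + 1) := by
      intro k
      have h1 : P.Aadj (u (k + 1 + 1) - u (k + 1)) + P.Badj (v (k + 1) - v k)
          = P.residual (u (k + 1 + 1)) (v (k + 1)) - P.residual (u (k + 1)) (v k) := by
        simp only [Problem.residual, map_sub]
        abel
      have h2 := mul_le_mul_of_nonneg_left (norm_sub_sq_le (P.residual (u (k + 1 + 1)) (v (k + 1)))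
        (P.residual (u (k + 1)) (v k))) hσ.le
      rw [h1]
      have h3 := (hDb u' v' k).2.2.2.2.1
      have h4 := (hDb u' v' (k + 1)).2.2.2.2.1
      linarith
    have hQ : ∀ k, normSq a.Q (pair (u (k + 1 + 1) - u (k + 1)) (v (k + 1) - v k))
        ≤ 4 * D u' v' k + 4 * D u' v' (k + 1) := by
      intro k
      have h1 : pair (u (k + 1 + 1) - u (k + 1)) (v (k + 1) - v k)
          = pair (u (k + 1 + 1) - u') (v (k + 1) - v') - pair (u (k + 1) - u') (v k - v') := by
        rw [← pair_sub, sub_sub_sub_cancel_right, sub_sub_sub_cancel_right]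
      rw [h1]
      have h2 := normSq_sub_le ha.Q_psd (pair (u (k + 1 + 1) - u') (v (k + 1) - v'))
        (pair (u (k + 1) - u') (v k - v'))
      have h3 := (hDb u' v' k).2.1
      have h4 := (hDb u' v' (k + 1)).2.1
      linarith
    have hlim : Tendsto (fun k => normSq (a.Q + blockDiag
        (a.S + ((1 - a.τ) * a.σ) • (P.A ∘L P.Aadj)) (a.T + ((1 - a.τ) * a.σ) • (P.B ∘L P.Badj)))
        (pair (u (k + 1 + 1) - u (k + 1)) (v (k + 1) - v k))) atTop (𝓝 0) := by
      simp only [normSq_add_left, normSq_blockDiag, normSq_smul_left, P.normSq_AAadj,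
        P.normSq_BBadj]
      refine squeeze_zero (fun k => ?_) (fun k => ?_) hDD
      · have h1 := normSq_nonneg ha.Q_psd (pair (u (k + 1 + 1) - u (k + 1)) (v (k + 1) - v k))
        have h2 := normSq_nonneg ha.S_psd (u (k + 1 + 1) - u (k + 1))
        have h3 := normSq_nonneg ha.T_psd (v (k + 1) - v k)
        positivity
      · obtain ⟨h0, -, -, h3, h4, h5⟩ := hDb u' v' k
        obtain ⟨h0', -, h2', -, -, -⟩ := hDb u' v' (k + 1)
        have h6 : P.Badj (v (k + 1) - v k)
            = P.residual (u (k + 1)) (v (k + 1)) - P.residual (u (k + 1)) (v k) := by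
          rw [P.residual_sub_right (u (k + 1)) (v (k + 1)) (v k)]
          abel
        have h7 : P.Aadj (u (k + 1 + 1) - u (k + 1)) = (P.Aadj (u (k + 1 + 1) - u (k + 1))
            + P.Badj (v (k + 1) - v k)) - P.Badj (v (k + 1) - v k) := by abel
        have h8 : (1 - a.τ) * a.σ * ‖P.Badj (v (k + 1) - v k)‖ ^ 2 ≤ 8 * D u' v' k := by
          have h9 := mul_le_mul_of_nonneg_left (norm_sub_sq_le
            (P.residual (u (k + 1)) (v (k + 1))) (P.residual (u (k + 1)) (v k)))
            (mul_nonneg hτ1 hσ.le)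
          rw [← h6] at h9
          have h10 : (1 - a.τ) * (a.σ * ‖P.residual (u (k + 1)) (v k)‖ ^ 2)
              ≤ 1 * (a.σ * ‖P.residual (u (k + 1)) (v k)‖ ^ 2) :=
            mul_le_mul_of_nonneg_right hτ2 (by positivity)
          linarith
        have h11 : (1 - a.τ) * a.σ * ‖P.Aadj (u (k + 1 + 1) - u (k + 1))‖ ^ 2
            ≤ 24 * D u' v' k + 8 * D u' v' (k + 1) := by
          have h9 := mul_le_mul_of_nonneg_left (norm_sub_sq_le
            (P.Aadj (u (k + 1 + 1) - u (k + 1)) + P.Badj (v (k + 1) - v k))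
            (P.Badj (v (k + 1) - v k))) (mul_nonneg hτ1 hσ.le)
          rw [← h7] at h9
          have h10 : (1 - a.τ) * (a.σ * ‖P.Aadj (u (k + 1 + 1) - u (k + 1))
                + P.Badj (v (k + 1) - v k)‖ ^ 2)
              ≤ 1 * (a.σ * ‖P.Aadj (u (k + 1 + 1) - u (k + 1)) + P.Badj (v (k + 1) - v k)‖ ^ 2) :=
            mul_le_mul_of_nonneg_right hτ2 (by positivity)
          linarith [hsum k]
        linarith [hQ k]
    have hst : ∀ n : ℕ → ℕ, Tendsto n atTop atTop →
        Tendsto ((fun k => u (k + 1 + 1) - u (k + 1)) ∘ n) atTop (𝓝 0) →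
        Tendsto ((fun k => v (k + 1) - v k) ∘ n) atTop (𝓝 0) := by
      intro n hn hs
      have hN := tendsto_normSq_sub (block11 a.Q) hs
      have hAs := (tendsto_norm_sq_apply P.Aadj hs).const_mul (2 * a.σ)
      have hf := ((hDD.comp hn).add (hN.const_mul 2)).add hAs
      simp only [mul_zero, add_zero, sub_zero] at hf
      refine tendsto_zero_of_mul_norm_sq_le hc (fun i => ?_) hf
      simp only [Function.comp_apply]
      generalize n i = k
      have h1 := hcV (v (k + 1) - v k)
      have h2 := normSq_sub_le ha.Q_psd (pair (u (k + 1 + 1) - u (k + 1)) (v (k + 1) - v k))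
        (pair (u (k + 1 + 1) - u (k + 1)) 0)
      rw [← pair_sub, sub_self, sub_zero, ← normSq_block11, ← normSq_block22] at h2
      have h3 := mul_le_mul_of_nonneg_left (norm_sub_sq_le
        (P.Aadj (u (k + 1 + 1) - u (k + 1)) + P.Badj (v (k + 1) - v k))
        (P.Aadj (u (k + 1 + 1) - u (k + 1)))) hσ.le
      rw [add_sub_cancel_left] at h3
      have h4 := (hDb u' v' k).2.2.2.1
      have h5 := (hDb u' v' k).1
      have h6 := (hDb u' v' (k + 1)).1
      linarith [hsum k, hQ k]
    have hts : ∀ n : ℕ → ℕ, Tendsto n atTop atTop →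
        Tendsto ((fun k => v (k + 1) - v k) ∘ n) atTop (𝓝 0) →
        Tendsto ((fun k => u (k + 1 + 1) - u (k + 1)) ∘ n) atTop (𝓝 0) := by
      intro n hn ht
      have hN := tendsto_normSq_sub (block22 a.Q) ht
      have hBt := (tendsto_norm_sq_apply P.Badj ht).const_mul (2 * a.σ)
      have hf := ((hDD.comp hn).add (hN.const_mul 2)).add hBt
      simp only [mul_zero, add_zero, sub_zero] at hf
      refine tendsto_zero_of_mul_norm_sq_le hc (fun i => ?_) hf
      simp only [Function.comp_apply]
      generalize n i = k
      have h1 := hcU (u (k + 1 + 1) - u (k + 1))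
      have h2 := normSq_sub_le ha.Q_psd (pair (u (k + 1 + 1) - u (k + 1)) (v (k + 1) - v k))
        (pair 0 (v (k + 1) - v k))
      rw [← pair_sub, sub_self, sub_zero, ← normSq_block11, ← normSq_block22] at h2
      have h3 := mul_le_mul_of_nonneg_left (norm_sub_sq_le
        (P.Aadj (u (k + 1 + 1) - u (k + 1)) + P.Badj (v (k + 1) - v k))
        (P.Badj (v (k + 1) - v k))) hσ.le
      rw [add_sub_cancel_right] at h3
      have h4 := (hDb u' v' (k + 1)).2.2.1
      have h5 := (hDb u' v' k).1
      have h6 := (hDb u' v' (k + 1)).1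
      linarith [hsum k, hQ k]
    have hΔ := tendsto_zero_of_normSq_pair hcond
      (s := fun k => u (k + 1 + 1) - u (k + 1)) (t := fun k => v (k + 1) - v k)
      (R := 2 * √((c / 18)⁻¹ * Ψ u' v' x' 0))
      (fun k => by
        have h1 := norm_sub_le (u (k + 1 + 1) - u') (u (k + 1) - u')
        rw [sub_sub_sub_cancel_right] at h1
        linarith [(hR k).1, (hR (k + 1)).1])
      (fun k => by
        have h1 := norm_sub_le (v (k + 1) - v') (v k - v')
        rw [sub_sub_sub_cancel_right] at h1
        linarith [(hR k).2, (hR (k + 1)).2]) hlim hst hts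
    exact ⟨hΔ.1, hΔ.2, hres⟩
  obtain ⟨hΔu, hΔv, hres⟩ := hsteps
  refine hgen.convergesToSolution_of_merit hP ha hη hKKT
    ((tendsto_add_atTop_iff_nat (f := fun k => u (k + 1) - u k) 1).1 hΔu) hΔv
    ((tendsto_add_atTop_iff_nat (f := fun k => P.residual (u k) (v k)) 1).1 ?_)
    (fun u' v' x' k => Ψ u' v' x' (k + 1))
    (fun u' v' x' hK k l hkl => hanti u' v' x' hK (Nat.add_le_add_right hkl 1))
    (fun u' v' x' hK => ⟨c / 18, by positivity, fun k => hcoer u' v' x' hK (k + 1)⟩)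
    fun u' v' x' _ n _ hu hv hx => ?_
  · have h1 := hres.add ((P.Badj.continuous.tendsto 0).comp hΔv)
    rw [map_zero, add_zero] at h1
    refine h1.congr fun k => ?_
    rw [Function.comp_apply, P.residual_sub_right (u (k + 1)) (v (k + 1)) (v k), sub_add_cancel]
  · have h1 := (Params.tendsto_energy (a := a) (P := P) hu hv hx).add
      ((tendsto_normSq_sub (block22 a.Q) hv).const_mul (1 / 2))
    simpa [hΨ] using h1

end ShortStep

/-! ### Long steps -/

section LongStep

variable {U V X : Type*}
  [NormedAddCommGroup U] [InnerProductSpace ℝ U] [FiniteDimensional ℝ U]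
  [NormedAddCommGroup V] [InnerProductSpace ℝ V] [FiniteDimensional ℝ V]
  [NormedAddCommGroup X] [InnerProductSpace ℝ X] [FiniteDimensional ℝ X]
  {P : Problem U V X} {a : Params U V}

/-- Young's inequality on `⟨r, y⟩` with unit weights if `τ ≤ 1`, and through `‖r + τ y‖² ≥ 0` if `τ
> 1`. In the second case the surplus is `1 + τ - τ²` for `‖y‖²` and `(1 + τ - τ²) / τ` for `‖r'‖²`;
`ε` is the smaller one, positive exactly below the golden ratio. -/
theorem exists_residual_weights {τ : ℝ} (hτ₀ : 0 < τ) (hτ : τ < (1 + √5) / 2) :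
    ∃ l ε : ℝ, 0 ≤ l ∧ 0 < ε ∧ ∀ r' r y : X, l * (‖r'‖ ^ 2 - ‖r‖ ^ 2) + ε * (‖r'‖ ^ 2 + ‖y‖ ^ 2)
      ≤ (2 - τ) * ‖r'‖ ^ 2 + ‖y‖ ^ 2 - 2 * (1 - τ) * inner ℝ r y := by
  rcases le_or_gt τ 1 with h1 | h1
  · refine ⟨1 - τ, τ, sub_nonneg.2 h1, hτ₀, fun r' r y => ?_⟩
    have h2 := sq_nonneg ‖r - y‖
    rw [norm_sub_sq_real] at h2
    have h3 := mul_nonneg (sub_nonneg.2 h1) h2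
    have h4 := mul_nonneg (sub_nonneg.2 h1) (sq_nonneg ‖r'‖)
    linarith
  · have h5 : 0 < 1 + τ - τ ^ 2 := by
      have h6 := Real.sq_sqrt (show (0 : ℝ) ≤ 5 by norm_num)
      have h7 := Real.sqrt_nonneg 5
      nlinarith
    refine ⟨1 - τ⁻¹, (1 + τ - τ ^ 2) * τ⁻¹, ?_, by positivity, fun r' r y => ?_⟩
    · rw [sub_nonneg]
      exact inv_le_one_of_one_le₀ h1.le
    · have h2 := sq_nonneg ‖r + τ • y‖
      rw [norm_add_sq_real, real_inner_smul_right, norm_smul, mul_pow, Real.norm_eq_abs,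
        sq_abs] at h2
      have hinv : 0 < τ⁻¹ := inv_pos.2 hτ₀
      have hmul : τ⁻¹ * τ = 1 := inv_mul_cancel₀ hτ₀.ne'
      have h3 := mul_nonneg (mul_nonneg (sub_nonneg.2 h1.le) hinv.le) h2
      have h4 : (τ - 1) * τ⁻¹ * (‖r‖ ^ 2 + 2 * (τ * inner ℝ r y) + τ ^ 2 * ‖y‖ ^ 2)
          = (1 - τ⁻¹) * ‖r‖ ^ 2 + 2 * (τ - 1) * inner ℝ r y + (τ ^ 2 - τ) * ‖y‖ ^ 2 := by
        field_simp
      have h6 : (1 + τ - τ ^ 2) * τ⁻¹ = τ⁻¹ + 1 - τ := by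
        field_simp
      have h7 : (1 + τ - τ ^ 2) * τ⁻¹ * ‖y‖ ^ 2 ≤ (1 + τ - τ ^ 2) * ‖y‖ ^ 2 := by
        have : (1 + τ - τ ^ 2) * τ⁻¹ ≤ (1 + τ - τ ^ 2) * 1 :=
          mul_le_mul_of_nonneg_left (inv_le_one_of_one_le₀ h1.le) h5.le
        rw [mul_one] at this
        exact mul_le_mul_of_nonneg_right this (sq_nonneg _)
      rw [h4] at h3
      have h8 : (1 + τ - τ ^ 2) * τ⁻¹ * ‖r'‖ ^ 2 = (τ⁻¹ + 1 - τ) * ‖r'‖ ^ 2 := by rw [h6]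
      linarith

theorem Params.normSq_M (η : ℝ) (s : U) (t : V) :
    normSq (a.M η) (pair s t) = 1 / 4 * normSq a.Q (pair s t) + (normSq a.S s - η * normSq a.D₁ s)
      + (normSq a.T t - η * normSq a.D₂ t) := by
  rw [M, normSq_add_left, normSq_blockDiag, normSq_smul_left, normSq_sub_left, normSq_sub_left,
    normSq_smul_left, normSq_smul_left, add_assoc]

/-- With `w₁ = (e, f)` and `w₀ = (e - s, f - t)`, the inequality `‖w₀ - (0, t)‖²_Q ≥ 0` bounds the
right side below by `‖w₁‖²_Q - ½‖w₀‖²_Q` plus the telescoping `Q₂₂` term. Writing this as `¾(‖w₁‖²_Q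
- ‖w₀‖²_Q) + ¼(‖w₁‖²_Q + ‖w₀‖²_Q)` and using `‖w₁ - w₀‖²_Q ≤ 2‖w₁‖²_Q + 2‖w₀‖²_Q` leaves the
constant `1 / 8`. -/
theorem normSq_pair_telescope {Q : Prod2 U V →L[ℝ] Prod2 U V} (hQ : Q.IsPositive) (e s : U)
    (f t : V) :
    1 / 8 * normSq Q (pair s t) + 3 / 4 * (normSq Q (pair e f) - normSq Q (pair (e - s) (f - t)))
      + 1 / 2 * (normSq (block22 Q) f - normSq (block22 Q) (f - t))
      ≤ normSq Q (pair e f) - inner ℝ e (block12 Q t) + normSq (block22 Q) t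
        + inner ℝ s (block12 Q t) := by
  have h1 := normSq_sub_le hQ (pair e f) (pair (e - s) (f - t))
  rw [← pair_sub, sub_sub_cancel, sub_sub_cancel] at h1
  have h2 := normSq_nonneg hQ (pair (e - s) (f - t) - pair 0 t)
  rw [normSq_sub hQ.isSymmetric, inner_apply_pair hQ.isSymmetric, ← normSq_block22, map_zero,
    inner_zero_left, inner_zero_right, zero_add, add_zero, inner_sub_left, inner_sub_left] at h2
  have h3 : normSq (block22 Q) (f - t) = normSq (block22 Q) f - 2 * inner ℝ f (block22 Q t)
      + normSq (block22 Q) t := normSq_sub (isPositive_block22 hQ).isSymmetric f t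
  have h4 : inner ℝ t (block22 Q t) = normSq (block22 Q) t := rfl
  linarith

/-- The merit function for long steps. -/
def Params.longStepMerit (a : Params U V) (P : Problem U V X) (η l : ℝ) (u' : U) (v' : V) (x' : X)
    (u₀ u₁ : U) (v₀ v₁ : V) (x₁ : X) : ℝ :=
  a.energy P u' v' x' u₁ v₁ x₁ + 1 / 2 * normSq (block22 a.Q) (v₁ - v')
    + 3 / 4 * normSq a.Q (pair (u₁ - u') (v₁ - v'))
    + 1 / 2 * (normSq a.T (v₁ - v₀) + normSq a.D₂ (v₁ - v₀)) + η / 2 * normSq a.D₁ (u₁ - u₀)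
    + a.σ * l / 2 * ‖P.residual u₁ v₁‖ ^ 2

/-- The terms summed up in the descent estimate for long steps. -/
def Params.longStepGap (a : Params U V) (P : Problem U V X) (η ε : ℝ) (u₀ u₁ : U) (v₀ v₁ : V) : ℝ :=
  1 / 2 * normSq (a.M η) (pair (u₁ - u₀) (v₁ - v₀))
    + a.σ * ε / 2 * (‖P.residual u₁ v₁‖ ^ 2 + ‖P.Badj (v₁ - v₀)‖ ^ 2)

variable {u : ℕ → U} {v : ℕ → V} {x : ℕ → X}

/-- Adding `inner_residual_le` to `energy_descent` eliminates the product of the new residual with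
`B* Δv`. The `η D₁` error concerns the previous `u`-increment; the matching term of the merit
function moves it to the current one. What is left of the increments is half of `M`, its `¼ Q`
coming from the `1 / 8` in `normSq_pair_telescope`. -/
theorem Params.IsGenerated.longStepGap_le (hgen : a.IsGenerated P u v x) (hP : P.Standing)
    (ha : a.Admissible P.φ) {η : ℝ} (hη : a.CrossControl P.φ η) {u' : U} {v' : V} {x' : X}
    (hK : P.IsKKT u' v' x') {l ε : ℝ}
    (hlε : ∀ r' r y : X, l * (‖r'‖ ^ 2 - ‖r‖ ^ 2) + ε * (‖r'‖ ^ 2 + ‖y‖ ^ 2)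
      ≤ (2 - a.τ) * ‖r'‖ ^ 2 + ‖y‖ ^ 2 - 2 * (1 - a.τ) * inner ℝ r y) (k : ℕ) :
    a.longStepGap P η ε (u (k + 1)) (u (k + 1 + 1)) (v (k + 1)) (v (k + 1 + 1)) ≤
      a.longStepMerit P η l u' v' x' (u k) (u (k + 1)) (v k) (v (k + 1)) (x (k + 1))
      - a.longStepMerit P η l u' v' x' (u (k + 1)) (u (k + 1 + 1)) (v (k + 1)) (v (k + 1 + 1))
        (x (k + 1 + 1)) := by
  have h1 := energy_descent hP ha hη hK (hgen.uSubgradient_mem hP ha (k + 1))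
    (hgen.vSubgradient_mem hP ha (k + 1)) (hgen.step_x (k + 1))
  have h2 := inner_residual_le hP ha hη (hgen.vSubgradient_mem hP ha k)
    (hgen.vSubgradient_mem hP ha (k + 1)) (hgen.step_x k)
  have h3 := mul_le_mul_of_nonneg_left (hlε (P.residual (u (k + 1 + 1)) (v (k + 1 + 1)))
    (P.residual (u (k + 1)) (v (k + 1))) (P.Badj (v (k + 1 + 1) - v (k + 1)))) ha.σ_pos.le
  have h4 := normSq_pair_telescope ha.Q_psd (u (k + 1 + 1) - u') (u (k + 1 + 1) - u (k + 1))
    (v (k + 1 + 1) - v') (v (k + 1 + 1) - v (k + 1))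
  rw [sub_sub_sub_cancel_left, sub_sub_sub_cancel_left] at h4
  rw [Params.longStepGap, Params.longStepMerit, Params.longStepMerit, Params.normSq_M]
  linarith

/-- Convergence of the majorized ADMM for step lengths below the golden ratio. -/
theorem Params.IsGenerated.convergesToSolution_of_lt_goldenRatio (hgen : a.IsGenerated P u v x)
    (hP : P.Standing) (ha : a.Admissible P.φ) {η : ℝ} (hη : a.CrossControl P.φ η)
    (hKKT : ∃ u' v' x', P.IsKKT u' v' x')
    (hpd₁ : PosDef (block11 a.Q + a.σ • (P.A ∘L P.Aadj) + a.S))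
    (hpd₂ : PosDef (block22 a.Q + a.σ • (P.B ∘L P.Badj) + a.T))
    (hτ : a.τ < (1 + √5) / 2) (hM : (a.M η).IsPositive)
    (hpdM₁ : PosDef ((1 / 4 : ℝ) • block11 a.Q + a.S + a.σ • (P.A ∘L P.Aadj) - η • a.D₁))
    (hpdM₂ : PosDef ((1 / 4 : ℝ) • block22 a.Q + a.T + a.σ • (P.B ∘L P.Badj) - η • a.D₂))
    (hcond : ∀ w : Prod2 U V, inner ℝ w ((a.M η + a.σ • blockDiag
      (P.A ∘L P.Aadj) (P.B ∘L P.Badj)) w) = 0 → ‖w.fst‖ * ‖w.snd‖ = 0) :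
    ConvergesToSolution P u v x := by
  have hσ := ha.σ_pos
  have hτ0 := ha.τ_pos
  obtain ⟨l, ε, hl, hε, hlε⟩ := exists_residual_weights (X := X) hτ0 hτ
  obtain ⟨c, hc, hcE, hcU, -⟩ := Params.exists_coercive ha hpd₁ hpd₂
  set Ψ : U → V → X → ℕ → ℝ := fun u' v' x' k =>
    a.longStepMerit P η l u' v' x' (u k) (u (k + 1)) (v k) (v (k + 1)) (x (k + 1)) with hΨ
  set D : ℕ → ℝ := fun k =>
    a.longStepGap P η ε (u (k + 1)) (u (k + 1 + 1)) (v (k + 1)) (v (k + 1 + 1)) with hD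
  have hMnn : ∀ s t, 0 ≤ normSq (a.M η) (pair s t) := fun s t => normSq_nonneg hM _
  have hD0 : ∀ k, 0 ≤ D k := fun k => by
    have := hMnn (u (k + 1 + 1) - u (k + 1)) (v (k + 1 + 1) - v (k + 1))
    simp only [hD, Params.longStepGap]
    positivity
  have hDM : ∀ k, normSq (a.M η) (pair (u (k + 1 + 1) - u (k + 1)) (v (k + 1 + 1) - v (k + 1)))
      ≤ 2 * D k := fun k => by
    have : 0 ≤ a.σ * ε / 2 * (‖P.residual (u (k + 1 + 1)) (v (k + 1 + 1))‖ ^ 2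
        + ‖P.Badj (v (k + 1 + 1) - v (k + 1))‖ ^ 2) := by positivity
    simp only [hD, Params.longStepGap]
    linarith
  have hDr : ∀ k, a.σ * ε * ‖P.residual (u (k + 1 + 1)) (v (k + 1 + 1))‖ ^ 2 ≤ 2 * D k :=
    fun k => by
    have h1 : 0 ≤ a.σ * ε * ‖P.Badj (v (k + 1 + 1) - v (k + 1))‖ ^ 2 := by positivity
    have h2 := hMnn (u (k + 1 + 1) - u (k + 1)) (v (k + 1 + 1) - v (k + 1))
    simp only [hD, Params.longStepGap]
    linarith
  have hDB : ∀ k, a.σ * ε * ‖P.Badj (v (k + 1 + 1) - v (k + 1))‖ ^ 2 ≤ 2 * D k := fun k => by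
    have h1 : 0 ≤ a.σ * ε * ‖P.residual (u (k + 1 + 1)) (v (k + 1 + 1))‖ ^ 2 := by positivity
    have h2 := hMnn (u (k + 1 + 1) - u (k + 1)) (v (k + 1 + 1) - v (k + 1))
    simp only [hD, Params.longStepGap]
    linarith
  have hdesc : ∀ u' v' x', P.IsKKT u' v' x' → ∀ k, D k ≤ Ψ u' v' x' k - Ψ u' v' x' (k + 1) :=
    fun u' v' x' hK k => hgen.longStepGap_le hP ha hη hK hlε k
  have hanti : ∀ u' v' x', P.IsKKT u' v' x' → Antitone (Ψ u' v' x') := fun u' v' x' hK =>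
    antitone_nat_of_succ_le fun k => by linarith [hD0 k, hdesc u' v' x' hK k]
  -- lower bounds for the merit function
  have hlow : ∀ u' v' x' k, 0 ≤ a.energy P u' v' x' (u (k + 1)) (v (k + 1)) (x (k + 1))
      ∧ 0 ≤ normSq (block22 a.Q) (v (k + 1) - v')
      ∧ 0 ≤ normSq a.Q (pair (u (k + 1) - u') (v (k + 1) - v'))
      ∧ a.energy P u' v' x' (u (k + 1)) (v (k + 1)) (x (k + 1))
        + 1 / 2 * normSq (block22 a.Q) (v (k + 1) - v')
        + 3 / 4 * normSq a.Q (pair (u (k + 1) - u') (v (k + 1) - v')) ≤ Ψ u' v' x' k := by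
    intro u' v' x' k
    refine ⟨Params.energy_nonneg ha _ _ _ _ _ _, normSq_nonneg (isPositive_block22 ha.Q_psd) _,
      normSq_nonneg ha.Q_psd _, ?_⟩
    have h1 := normSq_nonneg ha.T_psd (v (k + 1) - v k)
    have h2 := normSq_nonneg ha.D₂_psd (v (k + 1) - v k)
    have h3 := mul_nonneg hη.1.1 (normSq_nonneg ha.D₁_psd (u (k + 1) - u k))
    have h4 : 0 ≤ a.σ * l * ‖P.residual (u (k + 1)) (v (k + 1))‖ ^ 2 := by positivity
    simp only [hΨ, Params.longStepMerit]
    linarith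
  have hΨ0 : ∀ u' v' x' k, 0 ≤ Ψ u' v' x' k := fun u' v' x' k => by
    obtain ⟨h1, h2, h3, h4⟩ := hlow u' v' x' k
    linarith
  -- The part `4 * ε⁻¹` pays for the residual, which is bounded through the gap; the remaining terms
  -- need only 4, so 20 is generous.
  set c' : ℝ := c / (20 + 4 * ε⁻¹) with hc'
  have hden : 0 < 20 + 4 * ε⁻¹ := by positivity
  have hc'0 : 0 < c' := div_pos hc hden
  have hc'le : c' ≤ c := div_le_self hc.le (by linarith [inv_pos.2 hε])
  have hcoer : ∀ u' v' x', P.IsKKT u' v' x' → ∀ k, c' * ‖u (k + 2) - u'‖ ^ 2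
      ≤ Ψ u' v' x' k ∧ c' * ‖v (k + 1) - v'‖ ^ 2 ≤ Ψ u' v' x' k
      ∧ c' * ‖x (k + 1) - x'‖ ^ 2 ≤ Ψ u' v' x' k := by
    intro u' v' x' hK k
    obtain ⟨-, -, hQ0, hle⟩ := hlow u' v' x' k
    have h1 := hcE u' v' x' (u (k + 1)) (v (k + 1)) (x (k + 1))
    refine ⟨?_, ?_, ?_⟩
    · obtain ⟨hE', h22', hQ', hle'⟩ := hlow u' v' x' (k + 1)
      have hmono := hanti u' v' x' hK (Nat.le_succ k)
      have hd := hdesc u' v' x' hK k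
      have hp : pair (u (k + 1 + 1) - u') (0 : V)
          = pair (u (k + 1 + 1) - u') (v (k + 1 + 1) - v') - pair 0 (v (k + 1 + 1) - v') := by
        rw [← pair_sub, sub_zero, sub_self]
      have hA : P.Aadj (u (k + 1 + 1) - u')
          = P.residual (u (k + 1 + 1)) (v (k + 1 + 1)) - P.Badj (v (k + 1 + 1) - v') := by
        rw [P.residual_eq hK.2.2]
        abel
      have h2 := hcU (u (k + 1 + 1) - u')
      have h3 := normSq_sub_le ha.Q_psd (pair (u (k + 1 + 1) - u') (v (k + 1 + 1) - v'))
        (pair 0 (v (k + 1 + 1) - v'))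
      rw [← hp, ← normSq_block11, ← normSq_block22] at h3
      have h4 := norm_sub_sq_le (P.residual (u (k + 1 + 1)) (v (k + 1 + 1)))
        (P.Badj (v (k + 1 + 1) - v'))
      rw [← hA] at h4
      have h5 := mul_le_mul_of_nonneg_left h4 hσ.le
      have hSB : normSq a.S (u (k + 1 + 1) - u') + a.σ * ‖P.Badj (v (k + 1 + 1) - v')‖ ^ 2
          ≤ 2 * a.energy P u' v' x' (u (k + 1 + 1)) (v (k + 1 + 1)) (x (k + 1 + 1)) := by
        have h6 := normSq_nonneg ha.D₁_psd (u (k + 1 + 1) - u')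
        have h8 := normSq_nonneg ha.D₂_psd (v (k + 1 + 1) - v')
        have h9 := normSq_nonneg ha.T_psd (v (k + 1 + 1) - v')
        have h11 : 0 ≤ (a.τ * a.σ)⁻¹ * ‖x (k + 1 + 1) - x'‖ ^ 2 := by positivity
        rw [Params.energy]
        linarith
      have hr : a.σ * ‖P.residual (u (k + 1 + 1)) (v (k + 1 + 1))‖ ^ 2
          ≤ 2 * ε⁻¹ * Ψ u' v' x' k := by
        have h6 := mul_le_mul_of_nonneg_left (hDr k) (inv_pos.2 hε).le
        have h7 : ε⁻¹ * (a.σ * ε * ‖P.residual (u (k + 1 + 1)) (v (k + 1 + 1))‖ ^ 2)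
            = a.σ * ‖P.residual (u (k + 1 + 1)) (v (k + 1 + 1))‖ ^ 2 := by
          field_simp
        have h8 : ε⁻¹ * (2 * D k) ≤ ε⁻¹ * (2 * Ψ u' v' x' k) :=
          mul_le_mul_of_nonneg_left (by linarith [hΨ0 u' v' x' (k + 1)]) (inv_pos.2 hε).le
        rw [h7] at h6
        linarith
      have hnn : 0 ≤ normSq a.S (u (k + 1 + 1) - u') := normSq_nonneg ha.S_psd _
      have hnnB : 0 ≤ a.σ * ‖P.Badj (v (k + 1 + 1) - v')‖ ^ 2 := by positivity
      rw [hc', div_mul_eq_mul_div, div_le_iff₀ hden]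
      change c * ‖u (k + 1 + 1) - u'‖ ^ 2 ≤ _
      change Ψ u' v' x' (k + 1) ≤ _ at hmono
      linarith
    · exact (mul_le_mul_of_nonneg_right hc'le (sq_nonneg _)).trans (by linarith [h1.1])
    · exact (mul_le_mul_of_nonneg_right hc'le (sq_nonneg _)).trans (by linarith [h1.2])
  -- Shifted by two because the merit function bounds `u` only from index 2 on.
  have hsteps : Tendsto (fun k => u (k + 2 + 1) - u (k + 2)) atTop (𝓝 0) ∧
      Tendsto (fun k => v (k + 2 + 1) - v (k + 2)) atTop (𝓝 0) ∧
      Tendsto (fun k => P.residual (u k) (v k)) atTop (𝓝 0) := by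
    obtain ⟨u', v', x', hK⟩ := hKKT
    have hDlim : Tendsto D atTop (𝓝 0) :=
      tendsto_zero_of_le_sub (hΨ0 u' v' x') hD0 (hdesc u' v' x' hK)
    have hDlim2 : Tendsto (fun k => 2 * D k) atTop (𝓝 0) := by simpa using hDlim.const_mul 2
    have hDlim2' := hDlim2.comp (tendsto_add_atTop_nat 1)
    have hσε : 0 < a.σ * ε := mul_pos hσ hε
    have hr : Tendsto (fun k => P.residual (u k) (v k)) atTop (𝓝 0) :=
      (tendsto_add_atTop_iff_nat (f := fun k => P.residual (u k) (v k)) 2).1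
        (tendsto_zero_of_mul_norm_sq_le hσε hDr hDlim2)
    have hB : Tendsto (fun k => P.Badj (v (k + 2 + 1) - v (k + 2))) atTop (𝓝 0) :=
      tendsto_zero_of_mul_norm_sq_le hσε (fun k => hDB (k + 1)) hDlim2'
    have hA : Tendsto (fun k => P.Aadj (u (k + 2 + 1) - u (k + 2))) atTop (𝓝 0) := by
      have h1 := ((hr.comp (tendsto_add_atTop_nat 3)).sub (hr.comp (tendsto_add_atTop_nat 2))).sub hB
      rw [sub_zero, sub_zero] at h1
      refine h1.congr fun k => ?_
      simp only [Function.comp_apply, Problem.residual, map_sub]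
      abel
    have hMlim : Tendsto (fun k => normSq (a.M η)
        (pair (u (k + 2 + 1) - u (k + 2)) (v (k + 2 + 1) - v (k + 2)))) atTop (𝓝 0) :=
      squeeze_zero (fun k => hMnn _ _) (fun k => hDM (k + 1)) hDlim2'
    have hlim : Tendsto (fun k => normSq (a.M η + a.σ • blockDiag (P.A ∘L P.Aadj) (P.B ∘L P.Badj))
        (pair (u (k + 2 + 1) - u (k + 2)) (v (k + 2 + 1) - v (k + 2)))) atTop (𝓝 0) := by
      simp only [normSq_add_left, normSq_smul_left, normSq_blockDiag, P.normSq_AAadj,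
        P.normSq_BBadj]
      simpa using hMlim.add (((hA.norm.pow 2).add (hB.norm.pow 2)).const_mul a.σ)
    -- These operators are the diagonal blocks of `M` plus `σ A A*` or `σ B B*`. Since `M`, `A* Δu`
    -- and `B* Δv` vanish asymptotically, either increment tending to zero drags the other along.
    obtain ⟨c₁, hc₁, h₁⟩ := hpdM₁.exists_coercive
    obtain ⟨c₂, hc₂, h₂⟩ := hpdM₂.exists_coercive
    simp only [normSq_sub_left, normSq_add_left, normSq_smul_left, P.normSq_AAadj,
      normSq_block11] at h₁
    simp only [normSq_sub_left, normSq_add_left, normSq_smul_left, P.normSq_BBadj,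
      normSq_block22] at h₂
    have hst : ∀ n : ℕ → ℕ, Tendsto n atTop atTop →
        Tendsto ((fun k => u (k + 2 + 1) - u (k + 2)) ∘ n) atTop (𝓝 0) →
        Tendsto ((fun k => v (k + 2 + 1) - v (k + 2)) ∘ n) atTop (𝓝 0) := by
      intro n hn hs
      have hN : Tendsto (fun i => normSq (a.M η)
          (pair (u (n i + 2 + 1) - u (n i + 2)) (0 : V))) atTop (𝓝 0) := by
        have h1 := ((continuous_normSq (a.M η)).tendsto _).comp
          (((inl U V).continuous.tendsto 0).comp hs)
        rw [map_zero, normSq_zero] at h1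
        exact h1
      have hf := (((hMlim.comp hn).const_mul 2).add (hN.const_mul 2)).add
        (((hB.comp hn).norm.pow 2).const_mul a.σ)
      simp only [mul_zero, add_zero, norm_zero, ne_eq, OfNat.ofNat_ne_zero, not_false_eq_true,
        zero_pow] at hf
      refine tendsto_zero_of_mul_norm_sq_le hc₂ (fun i => ?_) hf
      simp only [Function.comp_apply]
      generalize n i = k
      have h1 := h₂ (v (k + 2 + 1) - v (k + 2))
      have h2 := normSq_sub_le hM (pair (u (k + 2 + 1) - u (k + 2)) (v (k + 2 + 1) - v (k + 2)))
        (pair (u (k + 2 + 1) - u (k + 2)) 0)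
      rw [← pair_sub, sub_self, sub_zero, Params.normSq_M, normSq_zero, normSq_zero] at h2
      linarith
    have hts : ∀ n : ℕ → ℕ, Tendsto n atTop atTop →
        Tendsto ((fun k => v (k + 2 + 1) - v (k + 2)) ∘ n) atTop (𝓝 0) →
        Tendsto ((fun k => u (k + 2 + 1) - u (k + 2)) ∘ n) atTop (𝓝 0) := by
      intro n hn ht
      have hN : Tendsto (fun i => normSq (a.M η)
          (pair (0 : U) (v (n i + 2 + 1) - v (n i + 2)))) atTop (𝓝 0) := by
        have h1 := ((continuous_normSq (a.M η)).tendsto _).comp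
          (((inr U V).continuous.tendsto 0).comp ht)
        rw [map_zero, normSq_zero] at h1
        exact h1
      have hf := (((hMlim.comp hn).const_mul 2).add (hN.const_mul 2)).add
        (((hA.comp hn).norm.pow 2).const_mul a.σ)
      simp only [mul_zero, add_zero, norm_zero, ne_eq, OfNat.ofNat_ne_zero, not_false_eq_true,
        zero_pow] at hf
      refine tendsto_zero_of_mul_norm_sq_le hc₁ (fun i => ?_) hf
      simp only [Function.comp_apply]
      generalize n i = k
      have h1 := h₁ (u (k + 2 + 1) - u (k + 2))
      have h2 := normSq_sub_le hM (pair (u (k + 2 + 1) - u (k + 2)) (v (k + 2 + 1) - v (k + 2)))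
        (pair 0 (v (k + 2 + 1) - v (k + 2)))
      rw [← pair_sub, sub_self, sub_zero, Params.normSq_M, normSq_zero, normSq_zero] at h2
      linarith
    have hR : ∀ k, ‖u (k + 2) - u'‖ ≤ √(c'⁻¹ * Ψ u' v' x' 0) ∧
        ‖v (k + 1) - v'‖ ≤ √(c'⁻¹ * Ψ u' v' x' 0) := by
      intro k
      have h0 := hanti u' v' x' hK (Nat.zero_le k)
      have h1 := hcoer u' v' x' hK k
      exact ⟨mem_closedBall_iff_norm.1 (mem_closedBall_of_mul_norm_sq_le hc'0 (h1.1.trans h0)),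
        mem_closedBall_iff_norm.1 (mem_closedBall_of_mul_norm_sq_le hc'0 (h1.2.1.trans h0))⟩
    have hΔ := tendsto_zero_of_normSq_pair hcond
      (s := fun k => u (k + 2 + 1) - u (k + 2)) (t := fun k => v (k + 2 + 1) - v (k + 2))
      (R := 2 * √(c'⁻¹ * Ψ u' v' x' 0))
      (fun k => by
        have h1 := norm_sub_le (u (k + 1 + 2) - u') (u (k + 2) - u')
        rw [sub_sub_sub_cancel_right] at h1
        exact h1.trans (by linarith [(hR k).1, (hR (k + 1)).1]))
      (fun k => by
        have h1 := norm_sub_le (v (k + 2 + 1) - v') (v (k + 1 + 1) - v')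
        rw [sub_sub_sub_cancel_right] at h1
        exact h1.trans (by linarith [(hR (k + 1)).2, (hR (k + 2)).2])) hlim hst hts
    exact ⟨hΔ.1, hΔ.2, hr⟩
  obtain ⟨hΔu2, hΔv2, hr⟩ := hsteps
  have hΔu : Tendsto (fun k => u (k + 1) - u k) atTop (𝓝 0) :=
    (tendsto_add_atTop_iff_nat (f := fun k => u (k + 1) - u k) 2).1 hΔu2
  have hΔv : Tendsto (fun k => v (k + 1) - v k) atTop (𝓝 0) :=
    (tendsto_add_atTop_iff_nat (f := fun k => v (k + 1) - v k) 2).1 hΔv2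
  refine hgen.convergesToSolution_of_merit hP ha hη hKKT hΔu hΔv hr Ψ hanti
    (fun u' v' x' hK => ⟨c', hc'0, hcoer u' v' x' hK⟩) fun u' v' x' _ n hn hu hv hx => ?_
  have hw : Tendsto (fun i => pair (u (n i + 1)) (v (n i + 1))) atTop (𝓝 (pair u' v')) :=
    (continuous_pair.tendsto (u', v')).comp (hu.prodMk_nhds hv)
  have h1 := tendsto_normSq_sub a.T (hΔv.comp hn)
  have h2 := tendsto_normSq_sub a.D₂ (hΔv.comp hn)
  have h3 := tendsto_normSq_sub a.D₁ (hΔu.comp hn)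
  have h4 := tendsto_normSq_sub a.Q hw
  have h5 := tendsto_normSq_sub (block22 a.Q) hv
  have h6 := (hr.comp ((tendsto_add_atTop_nat 1).comp hn)).norm.pow 2
  have h7 := Params.tendsto_energy (a := a) (P := P) hu hv hx
  have h8 := ((((h7.add (h5.const_mul (1 / 2))).add (h4.const_mul (3 / 4))).add
    ((h1.add h2).const_mul (1 / 2))).add (h3.const_mul (η / 2))).add (h6.const_mul (a.σ * l / 2))
  simp only [sub_zero, mul_zero, add_zero, norm_zero, ne_eq, OfNat.ofNat_ne_zero,
    not_false_eq_true, zero_pow] at h8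
  exact h8

end LongStep

end MajorizedADMM

end

theorem theorem4p1 {U V X : Type*}
    [NormedAddCommGroup U] [InnerProductSpace ℝ U] [FiniteDimensional ℝ U]
    [NormedAddCommGroup V] [InnerProductSpace ℝ V] [FiniteDimensional ℝ V]
    [NormedAddCommGroup X] [InnerProductSpace ℝ X] [FiniteDimensional ℝ X]
    (P : MajorizedADMM.Problem U V X) (hP : P.Standing)
    (a : MajorizedADMM.Params U V) (ha : a.Admissible P.φ)
    (η : ℝ) (hη : a.CrossControl P.φ η)
    (hsol : ∃ u v, P.IsSolution u v)
    (hCQ : P.ConstraintQualification)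
    (hpd₁ : MajorizedADMM.PosDef
      (MajorizedADMM.block11 a.Q + a.σ • (P.A ∘L P.Aadj) + a.S))
    (hpd₂ : MajorizedADMM.PosDef
      (MajorizedADMM.block22 a.Q + a.σ • (P.B ∘L P.Badj) + a.T))
    (u : ℕ → U) (v : ℕ → V) (x : ℕ → X) (hgen : a.IsGenerated P u v x) :
    -- case (i)
    (a.τ ∈ Set.Ioc (0 : ℝ) 1 →
      (∀ w : MajorizedADMM.Prod2 U V,
        inner ℝ w ((a.Q + MajorizedADMM.blockDiag
          (a.S + ((1 - a.τ) * a.σ) • (P.A ∘L P.Aadj))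
          (a.T + ((1 - a.τ) * a.σ) • (P.B ∘L P.Badj))) w) = 0 →
        ‖w.fst‖ * ‖w.snd‖ = 0) →
      MajorizedADMM.ConvergesToSolution P u v x) ∧
    -- case (ii)
    (a.τ ∈ Set.Ioo (0 : ℝ) ((1 + Real.sqrt 5) / 2) →
      (a.M η).IsPositive →
      MajorizedADMM.PosDef ((1 / 4 : ℝ) • MajorizedADMM.block11 a.Q + a.S
        + a.σ • (P.A ∘L P.Aadj) - η • a.D₁) →
      MajorizedADMM.PosDef ((1 / 4 : ℝ) • MajorizedADMM.block22 a.Q + a.T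
        + a.σ • (P.B ∘L P.Badj) - η • a.D₂) →
      (∀ w : MajorizedADMM.Prod2 U V,
        inner ℝ w ((a.M η + a.σ • MajorizedADMM.blockDiag
          (P.A ∘L P.Aadj) (P.B ∘L P.Badj)) w) = 0 →
        ‖w.fst‖ * ‖w.snd‖ = 0) →
      MajorizedADMM.ConvergesToSolution P u v x) := by
  obtain ⟨u₀, v₀, h₀⟩ := hsol
  obtain ⟨x₀, hK⟩ := P.exists_isKKT hP ha hη hCQ h₀
  exact ⟨fun hτ hcond => hgen.convergesToSolution_of_le_one hP ha hη ⟨u₀, v₀, x₀, hK⟩ hpd₁ hpd₂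
      hτ.2 hcond,
    fun hτ hM h₁ h₂ hcond => hgen.convergesToSolution_of_lt_goldenRatio hP ha hη
      ⟨u₀, v₀, x₀, hK⟩ hpd₁ hpd₂ hτ.2 hM h₁ h₂ hcond⟩
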